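/- Let $d\ge 1$ and $\ell\ge 0$ be integers, and let $p,q,r\in(1,\infty)$ satisfy $q\le r\le q'$ and $p\le r$, where $1/q+1/q'=1$. Let $\upsilon\colon\mathbb{R}^d\to[0,\infty)$ be a radial, radially non-decreasing weight (write $\upsilon(x)=\upsilon(|x|)$), positive almost everywhere, of Muckenhoupt class $A_q(\mathbb{R}^d)$: $\upsilon$ is locally integrable and there is a constant $K$ such that for all balls $B\subset\mathbb{R}^d$ $$\frac1{|B|}\Big(\int_B\upsilon\,dx\Big)^{1/q}\Big(\int_B\upsilon^{1-q'}dx\Big)^{1/q'}\le K .$$ Set $$\omega(\xi)=\upsilon(|\xi|)^{1/q},\qquad \vartheta(x)=|x|^{d\left(\frac1{q'}-\frac1r\right)}\,\omega\!\left(\frac1{|x|}\right)=|x|^{d\left(\frac1{q'}-\frac1r\right)}\,\upsilon\!\left(\frac1{|x|}\right)^{1/q}.$$ For $f\in L^1(\mathbb{R}^d)$ (real- or complex-valued) let $\hat f(\xi)=(2\pi)^{-d/2}\int f(x)e^{-i\langle x,\xi\rangle}dx$, let $\langle\xi\rangle=(1+|\xi|^2)^{1/2}$, and say that $f\in\mathcal{F}L^q(\omega\langle\cdot\rangle^\ell)$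 if $f\in L^1(\mathbb{R}^d)$ and $\|f\|_{\mathcal{F}L^q(\omega\langle\cdot\rangle^\ell)}:=\|\omega\langle\cdot\rangle^\ell\hat f\|_{L^q(\mathbb{R}^d)}<\infty$. For a measurable set $U\subset\mathbb{R}^d$ let $$\|f\|_{W^{\ell,p}(\vartheta;U)}=\Big(\sum_{|\alpha|\le\ell}\|\vartheta\,\partial^\alpha f\|_{L^p(U)}^p\Big)^{1/p},$$ with weak derivatives on $U$ if $U$ is open, and on an open set containing $U$ in general; $W^{\ell,p}(\vartheta;U)$ consists of the $f$ for which these derivatives exist and the norm is finite. Then there is a constant $C$, depending only on $d,\ell,p,q,r$ and the constant $K$, such that for every bounded measurable set $U\subset\mathbb{R}^d$ and every $f\in\mathcal{F}L^q(\omega\langle\cdot\rangle^\ell)$ one has $f\in W^{\ell,p}(\vartheta;U)$ and $$\|f\|_{W^{\ell,p}(\vartheta;U)}\le C\,|U|^{\frac1p-\frac1r}\,\|f\|_{\mathcal{F}L^q(\omega\langle\cdot\rangle^\ell)} .$$ -/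

import Mathlib

open MeasureTheory
open scoped ENNReal NNReal

noncomputable section

namespace WeightedFourier

/-- The Fourier transform on `ℝ^d` in the symmetric normalisation
`(2π)^{-d/2} ∫ f(x) e^{-i⟨x,ξ⟩} dx` (used for integrable `f` only). -/
def fourierSym {d : ℕ} (f : EuclideanSpace ℝ (Fin d) → ℂ) (ξ : EuclideanSpace ℝ (Fin d)) : ℂ :=
  (((2 * Real.pi) ^ (-((d : ℝ) / 2)) : ℝ) : ℂ) *
    ∫ x, Complex.exp (-(Complex.I * ((inner ℝ x ξ : ℝ) : ℂ))) * f x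

/-- The bracket `⟨x⟩ = (1 + |x|²)^{1/2}`. -/
def bracket {d : ℕ} (x : EuclideanSpace ℝ (Fin d)) : ℝ := Real.sqrt (1 + ‖x‖ ^ 2)

/-- `w` is a Muckenhoupt weight of class `A_p` on `ℝ^d` with constant at most `K`; here `p'` is the
conjugate exponent of `p`. The integrals are taken in `[0, ∞]` (a zero of `w` makes `w^{1-p'}`
infinite), and, as usual, a weight is positive almost everywhere. -/
structure IsMuckenhoupt {d : ℕ} (p p' : ℝ) (K : ℝ≥0) (w : EuclideanSpace ℝ (Fin d) → ℝ) :
    Prop where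
  nonneg : ∀ x, 0 ≤ w x
  pos_ae : ∀ᵐ x, 0 < w x
  locallyIntegrable : LocallyIntegrable w
  ball_le : ∀ (c : EuclideanSpace ℝ (Fin d)) (R : ℝ), 0 < R →
    (volume (Metric.ball c R))⁻¹ *
      (∫⁻ x in Metric.ball c R, ENNReal.ofReal (w x)) ^ (1 / p) *
      (∫⁻ x in Metric.ball c R, ENNReal.ofReal (w x) ^ (1 - p')) ^ (1 / p') ≤ K

/-- The classical partial derivative `∂^α φ = ∂_0^{α_0} ⋯ ∂_{d-1}^{α_{d-1}} φ` of a smooth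
function. -/
def partialDeriv {d : ℕ} (α : Fin d → ℕ) (φ : EuclideanSpace ℝ (Fin d) → ℝ) :
    EuclideanSpace ℝ (Fin d) → ℝ :=
  (List.finRange d).foldr
    (fun i g => (fun h x => lineDeriv ℝ h x (EuclideanSpace.single i 1))^[α i] g) φ

/-- `g` is a weak derivative `∂^α f` on the open set `Ω`: both are locally integrable on `Ω` and
`∫ f ∂^α φ = (-1)^{|α|} ∫ g φ` for all test functions `φ ∈ C_c^∞(Ω)`. -/
structure IsWeakDerivOnOpen {d : ℕ} (α : Fin d → ℕ) (f g : EuclideanSpace ℝ (Fin d) → ℂ)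
    (Ω : Set (EuclideanSpace ℝ (Fin d))) : Prop where
  locallyIntegrableOn_left : LocallyIntegrableOn f Ω
  locallyIntegrableOn_right : LocallyIntegrableOn g Ω
  integral_eq : ∀ φ : EuclideanSpace ℝ (Fin d) → ℝ, ContDiff ℝ ((⊤ : ℕ∞) : WithTop ℕ∞) φ → HasCompactSupport φ →
    tsupport φ ⊆ Ω →
      ∫ x, partialDeriv α φ x • f x = (-1 : ℝ) ^ (∑ i, α i) • ∫ x, φ x • g x

/-- `g` is a weak derivative `∂^α f` on `U`. If `U` is open, this is the usual notion on `U`; for a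
general set it means a weak derivative on some open set that contains `U`. -/
def IsWeakDeriv {d : ℕ} (α : Fin d → ℕ) (f g : EuclideanSpace ℝ (Fin d) → ℂ)
    (U : Set (EuclideanSpace ℝ (Fin d))) : Prop :=
  ∃ Ω, IsOpen Ω ∧ U ⊆ Ω ∧ IsWeakDerivOnOpen α f g Ω

/-- The multi-indices `α` with `|α| ≤ m`. -/
def multiIndices (d m : ℕ) : Finset (Fin d → ℕ) :=
  (Finset.range (m + 1)).biUnion fun k => Finset.piAntidiag Finset.univ k

theorem mem_multiIndices {d m : ℕ} {α : Fin d → ℕ} :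
    α ∈ multiIndices d m ↔ ∑ i, α i ≤ m := by
  simp [multiIndices, Finset.mem_piAntidiag]

/-- Membership in the weighted Sobolev space `W^{m,p}(w; U)`, `1 ≤ p < ∞`: for every `|α| ≤ m` the
weak derivative `∂^α f` exists on `U` and `w ∂^α f ∈ L^p(U)`. -/
def MemSobolev {d : ℕ} (m : ℕ) (p : ℝ) (w : EuclideanSpace ℝ (Fin d) → ℝ)
    (U : Set (EuclideanSpace ℝ (Fin d))) (f : EuclideanSpace ℝ (Fin d) → ℂ) : Prop :=
  ∀ α : Fin d → ℕ, ∑ i, α i ≤ m → ∃ g, IsWeakDeriv α f g U ∧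
    MemLp (fun x => (w x : ℂ) * g x) (ENNReal.ofReal p) (volume.restrict U)

/-- The norm of `W^{m,p}(w; U)`, `1 ≤ p < ∞`: `(∑_{|α| ≤ m} ‖w ∂^α f‖_{L^p(U)}^p)^{1/p}`. The infimum
runs over the versions `g` of the weak derivative `∂^α f`, which agree almost everywhere on `U`;
it is `∞` if there is no weak derivative. -/
def sobolevENorm {d : ℕ} (m : ℕ) (p : ℝ) (w : EuclideanSpace ℝ (Fin d) → ℝ)
    (U : Set (EuclideanSpace ℝ (Fin d))) (f : EuclideanSpace ℝ (Fin d) → ℂ) : ℝ≥0∞ :=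
  (∑ α ∈ multiIndices d m,
    (⨅ (g : EuclideanSpace ℝ (Fin d) → ℂ) (_ : IsWeakDeriv α f g U),
      eLpNorm (fun x => (w x : ℂ) * g x) (ENNReal.ofReal p) (volume.restrict U)) ^ p) ^ (1 / p)

/-- Membership in the weighted Fourier-Lebesgue space `FL^q(w)` on all of `ℝ^d`:
`f ∈ L^1` and `w f̂ ∈ L^q`. -/
def MemFourierLebesgue {d : ℕ} (q : ℝ) (w : EuclideanSpace ℝ (Fin d) → ℝ)
    (f : EuclideanSpace ℝ (Fin d) → ℂ) : Prop :=
  Integrable f ∧ MemLp (fun ξ => (w ξ : ℂ) * fourierSym f ξ) (ENNReal.ofReal q)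

/-- The norm `‖w f̂‖_{L^q}` of `FL^q(w)` on all of `ℝ^d`. -/
def fourierLebesgueENorm {d : ℕ} (q : ℝ) (w : EuclideanSpace ℝ (Fin d) → ℝ)
    (f : EuclideanSpace ℝ (Fin d) → ℂ) : ℝ≥0∞ :=
  eLpNorm (fun ξ => (w ξ : ℂ) * fourierSym f ξ) (ENNReal.ofReal q) volume

end WeightedFourier

end

namespace WeightedFourier

open Filter Topology FourierTransform SchwartzMap

variable {d : ℕ}

/-! Since `p ≤ r`, Hölder's inequality on `U` costs the factor `|U|^{1/p-1/r}`, so it suffices to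
bound `ϑ ∂^α f` in `L^r(ℝ^d)`. Up to a constant, `∂^α f` is the inverse Fourier transform of `g =
(iξ)^α f̂`, and `|g| ≤ ⟨ξ⟩^ℓ |f̂|` for `|α| ≤ ℓ`. With `w = υ^{1/q}` everything reduces to a
weighted Pitt inequality (`pitt_weighted`): the `L^r` norm of `|x|^{d(1/q'-1/r)} w(1/|x|) ǧ(x)` is
at most a constant times the `L^q` norm of `w(|ξ|) g(ξ)`.

For `w = 1` the endpoints are Paley's inequality (`r = q`) and the Hausdorff–Young inequality (`r =
q'`). Each follows by cutting `g` at a height depending on the level, with the trivial `L¹ → L^∞`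
bound for the high part and Plancherel for the low part. Hölder interpolates between them
(`pitt_unweighted`).

For general `w`, the weight `w(1/|x|)^r` is written as an integral over its levels `t`. At level `t`
the function `g` is split into the part where `w(|ξ|)^r > t`, to which the unweighted inequality
applies, and the rest. By monotonicity the rest lies in the ball `|ξ| ≤ 1/|x|` for every relevant
`x`, so it is dominated by the Hardy-type operator `∫_{|ξ| ≤ 1/|x|} |g|`. The condition `A_q` enters
in `hardy`: it makes the mean of `w^{-q'}` over a ball about the origin comparable to the boundary
value, and hence leaves room for a small extra power `|ξ|^{-γ}`.

All this is proved for `g ∈ L¹ ∩ L²`. For the actual `g`, the transforms of truncations to balls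
converge in `L^{q'}`; Fatou's lemma keeps the estimate, and Parseval's formula shows that the limit
is the weak derivative. -/

theorem lintegral_comp_smul {c : ℝ} (hc : 0 < c) (F : EuclideanSpace ℝ (Fin d) → ℝ≥0∞) :
    ∫⁻ x, F (c • x) = ENNReal.ofReal ((c ^ d)⁻¹) * ∫⁻ x, F x := by
  have h := lintegral_map_equiv (μ := (volume : Measure (EuclideanSpace ℝ (Fin d)))) F
    (Homeomorph.smulOfNeZero c hc.ne').toMeasurableEquiv
  have h2 : Measure.map (Homeomorph.smulOfNeZero c hc.ne' : EuclideanSpace ℝ (Fin d) ≃ₜ _).toMeasurableEquiv volume = Measure.map (c • ·) (volume : Measure (EuclideanSpace ℝ (Fin d))) := rfl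
  rw [h2, Measure.map_addHaar_smul volume hc.ne', lintegral_smul_measure] at h
  rw [abs_of_pos (by positivity), finrank_euclideanSpace_fin] at h
  exact h.symm

/-! ### The Fourier integral on `L¹` and Plancherel's identity -/

/-- The unnormalised inverse Fourier transform `∫ g(ξ) e^{i⟨x,ξ⟩} dξ`. -/
noncomputable def invFourier (g : EuclideanSpace ℝ (Fin d) → ℂ) (x : EuclideanSpace ℝ (Fin d)) : ℂ :=
  ∫ ξ, Complex.exp (Complex.I * ((inner ℝ x ξ : ℝ) : ℂ)) * g ξ

theorem norm_exp_I_mul (t : ℝ) : ‖Complex.exp (Complex.I * (t : ℂ))‖ = 1 := by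
  rw [mul_comm, Complex.norm_exp_ofReal_mul_I]

theorem integrable_exp_mul {g : EuclideanSpace ℝ (Fin d) → ℂ} (hg : Integrable g)
    (x : EuclideanSpace ℝ (Fin d)) :
    Integrable fun ξ => Complex.exp (Complex.I * ((inner ℝ x ξ : ℝ) : ℂ)) * g ξ := by
  refine hg.bdd_mul (c := 1) (by fun_prop) (Eventually.of_forall fun ξ => (norm_exp_I_mul _).le)

theorem invFourier_add {g h : EuclideanSpace ℝ (Fin d) → ℂ} (hg : Integrable g)
    (hh : Integrable h) (x : EuclideanSpace ℝ (Fin d)) :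
    invFourier (g + h) x = invFourier g x + invFourier h x := by
  simp only [invFourier, Pi.add_apply, mul_add]
  exact integral_add (integrable_exp_mul hg x) (integrable_exp_mul hh x)

theorem invFourier_sub {g h : EuclideanSpace ℝ (Fin d) → ℂ} (hg : Integrable g)
    (hh : Integrable h) (x : EuclideanSpace ℝ (Fin d)) :
    invFourier (g - h) x = invFourier g x - invFourier h x := by
  simp only [invFourier, Pi.sub_apply, mul_sub]
  exact integral_sub (integrable_exp_mul hg x) (integrable_exp_mul hh x)

theorem enorm_invFourier_le (g : EuclideanSpace ℝ (Fin d) → ℂ) (x : EuclideanSpace ℝ (Fin d)) :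
    ‖invFourier g x‖ₑ ≤ ∫⁻ ξ, ‖g ξ‖ₑ := by
  refine (enorm_integral_le_lintegral_enorm _).trans (lintegral_mono fun ξ => ?_)
  rw [enorm_mul, ← ofReal_norm (Complex.exp _), norm_exp_I_mul]
  simp

theorem invFourier_eq_fourierInv (g : EuclideanSpace ℝ (Fin d) → ℂ)
    (x : EuclideanSpace ℝ (Fin d)) :
    invFourier g x = 𝓕⁻ g ((2 * Real.pi)⁻¹ • x) := by
  rw [Real.fourierInv_eq', invFourier]
  congr 1
  ext ξ
  rw [smul_eq_mul, inner_smul_right, real_inner_comm]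
  congr 2
  push_cast
  field_simp

theorem fourierSym_eq_invFourier (f : EuclideanSpace ℝ (Fin d) → ℂ)
    (ξ : EuclideanSpace ℝ (Fin d)) :
    fourierSym f ξ = (((2 * Real.pi) ^ (-((d : ℝ) / 2)) : ℝ) : ℂ) * invFourier f (-ξ) := by
  rw [fourierSym, invFourier]
  congr 2
  ext x
  rw [inner_neg_left, real_inner_comm]
  push_cast
  rw [mul_neg]

theorem continuous_invFourier {g : EuclideanSpace ℝ (Fin d) → ℂ} (hg : Integrable g) :
    Continuous (invFourier g) := by
  refine continuous_of_dominated (bound := fun ξ => ‖g ξ‖) (fun x => ?_) (fun x => ?_) hg.norm ?_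
  · exact (integrable_exp_mul hg x).aestronglyMeasurable
  · refine Eventually.of_forall fun ξ => ?_
    rw [norm_mul, norm_exp_I_mul, one_mul]
  · refine Eventually.of_forall fun ξ => ?_
    fun_prop

theorem integral_invFourier_mul {g h : EuclideanSpace ℝ (Fin d) → ℂ} (hg : Integrable g)
    (hh : Integrable h) :
    ∫ x, invFourier g x * h x = ∫ x, g x * invFourier h x := by
  have h1 : ∀ x, invFourier g x * h x = ∫ ξ, Complex.exp (Complex.I * ((inner ℝ x ξ : ℝ) : ℂ)) * (g ξ * h x) := by
    intro x
    rw [invFourier, ← integral_mul_const]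
    simp only [mul_assoc]
  have h2 : ∀ ξ, g ξ * invFourier h ξ = ∫ x, Complex.exp (Complex.I * ((inner ℝ x ξ : ℝ) : ℂ)) * (g ξ * h x) := by
    intro ξ
    rw [invFourier, ← integral_const_mul]
    congr 1
    ext x
    rw [real_inner_comm]
    ring
  simp only [h1, h2]
  refine integral_integral_swap ?_
  have h3 : Integrable (fun z : EuclideanSpace ℝ (Fin d) × EuclideanSpace ℝ (Fin d) => g z.2 * h z.1) (volume.prod volume) := by
    simpa [mul_comm] using hh.mul_prod hg
  refine h3.bdd_mul (c := 1) (by fun_prop) (Eventually.of_forall fun ξ => (norm_exp_I_mul _).le)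

/-- The `L²` transform is an abstract isometry and the integral is pointwise. Both define the same
distribution, because in both cases the transform can be moved onto a test function, so they agree
almost everywhere. -/
theorem fourierInv_ae_eq_of_memLp_two {g : EuclideanSpace ℝ (Fin d) → ℂ} (hg : Integrable g)
    (hg2 : MemLp g 2) : (𝓕⁻ (hg2.toLp g) : Lp ℂ 2 (volume : Measure (EuclideanSpace ℝ (Fin d)))) =ᵐ[volume] 𝓕⁻ g := by
  have hc : Continuous (𝓕⁻ g) := by
    have h := (continuous_invFourier hg).comp (continuous_const_smul (2 * Real.pi))
    refine h.congr fun x => ?_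
    rw [Function.comp_apply, invFourier_eq_fourierInv, smul_smul, inv_mul_cancel₀ (by positivity), one_smul]
  refine ae_eq_of_integral_contDiff_smul_eq ?_ hc.locallyIntegrable ?_
  · exact (Lp.memLp _).locallyIntegrable one_le_two
  intro φ hφ hφc
  have hφ' : ContDiff ℝ ((⊤ : ℕ∞) : WithTop ℕ∞) (fun x => (φ x : ℂ)) := Complex.ofRealCLM.contDiff.comp hφ
  have hφc' : HasCompactSupport (fun x => (φ x : ℂ)) := hφc.comp_left (g := fun t : ℝ => (t : ℂ)) rfl
  set ψ : 𝓢(EuclideanSpace ℝ (Fin d), ℂ) := hφc'.toSchwartzMap hφ' with hψ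
  have hψ1 : ∀ x, ψ x = φ x := fun x => rfl
  have key := congrArg (fun u => u ψ) (Lp.fourierInv_toTemperedDistribution_eq (hg2.toLp g))
  simp only [TemperedDistribution.fourierInv_apply, Lp.toTemperedDistribution_apply] at key
  have e1 : ∫ x, (𝓕⁻ ψ) x • (hg2.toLp g) x = ∫ x, (𝓕⁻ ψ) x • g x := by
    refine integral_congr_ae ?_
    filter_upwards [hg2.coeFn_toLp] with x hx
    rw [hx]
  have e2 : ∫ x, (𝓕⁻ ψ) x • g x = ∫ x, ψ x • 𝓕⁻ g x := by
    have h := VectorFourier.integral_fourierIntegral_smul_eq_flip (μ := volume) (ν := volume)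
      (L := -innerₗ (EuclideanSpace ℝ (Fin d))) (f := ψ) (g := g) Real.continuous_fourierChar
      (by simpa using (by fun_prop : Continuous fun p : EuclideanSpace ℝ (Fin d) × EuclideanSpace ℝ (Fin d) => - inner ℝ p.1 p.2)) ψ.integrable hg
    have h' : (-innerₗ (EuclideanSpace ℝ (Fin d))).flip = -innerₗ (EuclideanSpace ℝ (Fin d)) := by
      ext x y
      simp [real_inner_comm]
    rw [h'] at h
    rw [SchwartzMap.fourierInv_coe]
    exact h
  simp only [← Complex.coe_smul]
  simp only [hψ1] at key e2
  rw [← key, e1, e2]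

/-- The factor `(2π)^d` is the Jacobian of `x ↦ x/(2π)`, which turns the kernel `e^{i⟨x,ξ⟩}` into
the unitary normalisation `e^{2πi⟨x,ξ⟩}`. -/
theorem lintegral_invFourier_sq {g : EuclideanSpace ℝ (Fin d) → ℂ} (hg : Integrable g)
    (hg2 : MemLp g 2) : ∫⁻ x, ‖invFourier g x‖ₑ ^ (2 : ℝ) = ENNReal.ofReal ((2 * Real.pi) ^ d) * ∫⁻ ξ, ‖g ξ‖ₑ ^ (2 : ℝ) := by
  have h1 : ∫⁻ x, ‖𝓕⁻ g x‖ₑ ^ (2 : ℝ) = ∫⁻ x, ‖g x‖ₑ ^ (2 : ℝ) := by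
    have h2 : ‖(𝓕⁻ (hg2.toLp g) : Lp ℂ 2 (volume : Measure (EuclideanSpace ℝ (Fin d))))‖ₑ = ‖hg2.toLp g‖ₑ := by
      rw [← ofReal_norm, ← ofReal_norm]
      congr 1
      exact (Lp.fourierTransformₗᵢ (EuclideanSpace ℝ (Fin d)) ℂ).symm.norm_map _
    rw [Lp.enorm_def, Lp.enorm_def, eLpNorm_congr_ae (fourierInv_ae_eq_of_memLp_two hg hg2),
      eLpNorm_congr_ae hg2.coeFn_toLp, eLpNorm_eq_lintegral_rpow_enorm_toReal (by simp) (by simp),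
      eLpNorm_eq_lintegral_rpow_enorm_toReal (by simp) (by simp)] at h2
    have h3 := congrArg (fun t => t ^ (2 : ℝ)) h2
    simpa only [← ENNReal.rpow_mul, ENNReal.toReal_ofNat, one_div, inv_mul_cancel₀ (two_ne_zero' ℝ),
      ENNReal.rpow_one] using h3
  simp only [invFourier_eq_fourierInv]
  rw [← h1, lintegral_comp_smul (by positivity) (fun x => ‖𝓕⁻ g x‖ₑ ^ (2 : ℝ)), inv_pow, inv_inv]

/-! ### Integrals of powers of the norm -/

theorem nontrivial_euclideanSpace (hd : 0 < d) : Nontrivial (EuclideanSpace ℝ (Fin d)) := by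
  have : NeZero d := ⟨hd.ne'⟩
  exact Module.nontrivial_of_finrank_pos (R := ℝ) (by simpa using hd)

theorem ae_ne_zero (hd : 0 < d) : ∀ᵐ x : EuclideanSpace ℝ (Fin d), x ≠ 0 := by
  have := nontrivial_euclideanSpace hd
  simp [ae_iff]

theorem enorm_rpow_eq_enorm {x : EuclideanSpace ℝ (Fin d)} (hx : x ≠ 0) (a : ℝ) :
    ‖‖x‖ ^ a‖ₑ = ‖x‖ₑ ^ a := by
  have h : 0 < ‖x‖ := norm_pos_iff.2 hx
  rw [Real.enorm_of_nonneg (by positivity), ← ENNReal.ofReal_rpow_of_pos h, ofReal_norm]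

/-- Homogeneity under `x = R y`. The set `S` of radii stays general because `Iio 1` gives balls and
`Ioi 1` gives their exteriors. -/
theorem setLIntegral_norm_rpow_scale (a : ℝ) {S : Set ℝ} (hS : MeasurableSet S) {R : ℝ}
    (hR : 0 < R) :
    ∫⁻ x in {x : EuclideanSpace ℝ (Fin d) | ‖x‖ / R ∈ S}, ‖x‖ₑ ^ a =
      ENNReal.ofReal R ^ (a + d) * ∫⁻ x in {x : EuclideanSpace ℝ (Fin d) | ‖x‖ ∈ S}, ‖x‖ₑ ^ a := by
  have hm1 : MeasurableSet {x : EuclideanSpace ℝ (Fin d) | ‖x‖ / R ∈ S} :=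
    (measurable_norm.div_const R) hS
  have hm2 : MeasurableSet {x : EuclideanSpace ℝ (Fin d) | ‖x‖ ∈ S} := measurable_norm hS
  have h0 : ENNReal.ofReal R ≠ 0 := by simpa using hR
  have h := lintegral_comp_smul (inv_pos.2 hR) ({x : EuclideanSpace ℝ (Fin d) | ‖x‖ ∈ S}.indicator fun x => ‖x‖ₑ ^ a)
  rw [lintegral_indicator hm2] at h
  have e : ∀ x : EuclideanSpace ℝ (Fin d), ({x : EuclideanSpace ℝ (Fin d) | ‖x‖ ∈ S}.indicator fun x => ‖x‖ₑ ^ a) (R⁻¹ • x) =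
      ENNReal.ofReal R ^ (-a) * ({x : EuclideanSpace ℝ (Fin d) | ‖x‖ / R ∈ S}.indicator fun x => ‖x‖ₑ ^ a) x := by
    classical
    intro x
    have hn : ‖R⁻¹ • x‖ = ‖x‖ / R := by
      rw [norm_smul, Real.norm_of_nonneg (by positivity)]; ring
    simp only [Set.indicator_apply, Set.mem_ofPred_eq, hn]
    split_ifs
    · rw [enorm_smul, ENNReal.mul_rpow_of_ne_top enorm_ne_top enorm_ne_top,
        Real.enorm_of_nonneg (by positivity), ENNReal.ofReal_inv_of_pos hR, ENNReal.inv_rpow,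
        ENNReal.rpow_neg]
    · simp
  simp only [e] at h
  rw [lintegral_const_mul _ (Measurable.indicator (by fun_prop) hm1), lintegral_indicator hm1] at h
  have h2 := congrArg (fun t => ENNReal.ofReal R ^ a * t) h
  simp only [← mul_assoc] at h2
  rw [← ENNReal.rpow_add _ _ h0 ENNReal.ofReal_ne_top, add_neg_cancel, ENNReal.rpow_zero, one_mul,
    inv_pow, inv_inv, ENNReal.ofReal_pow hR.le, ← ENNReal.rpow_natCast,
    ← ENNReal.rpow_add _ _ h0 ENNReal.ofReal_ne_top] at h2
  exact h2

theorem setLIntegral_ball_norm_rpow (hd : 0 < d) {s : ℝ} (hs : 0 < s) :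
    ∃ C : ℝ≥0, ∀ R : ℝ, 0 < R →
      ∫⁻ x in Metric.ball (0 : EuclideanSpace ℝ (Fin d)) R, ‖x‖ₑ ^ (s - d) ≤
        C * ENNReal.ofReal R ^ s := by
  have := nontrivial_euclideanSpace hd
  have hi : IntegrableOn (fun x : EuclideanSpace ℝ (Fin d) => ‖x‖ ^ (s - d)) (Metric.ball 0 1) := by
    rw [integrableOn_fun_norm_addHaar volume (f := fun y : ℝ => y ^ (s - d))]
    have h : IntegrableOn (fun y : ℝ => y ^ (s - 1)) (Set.Ioo 0 1) :=
      (intervalIntegral.integrableOn_Ioo_rpow_iff one_pos).2 (by linarith)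
    refine h.congr_fun (fun y hy => ?_) measurableSet_Ioo
    simp only [smul_eq_mul, finrank_euclideanSpace_fin]
    rw [← Real.rpow_natCast, ← Real.rpow_add hy.1, Nat.cast_sub hd]
    congr 1
    push_cast
    ring
  have hfin : ∫⁻ x in Metric.ball (0 : EuclideanSpace ℝ (Fin d)) 1, ‖x‖ₑ ^ (s - d) ≠ ∞ := by
    have h := hi.2
    rw [HasFiniteIntegral] at h
    refine (lt_of_le_of_lt (le_of_eq ?_) h).ne
    refine lintegral_congr_ae ?_
    filter_upwards [ae_restrict_of_ae (ae_ne_zero hd)] with x hx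
    rw [enorm_rpow_eq_enorm hx]
  lift (∫⁻ x in Metric.ball (0 : EuclideanSpace ℝ (Fin d)) 1, ‖x‖ₑ ^ (s - d)) to ℝ≥0 using hfin with C hC
  refine ⟨C, fun R hR => ?_⟩
  have h := setLIntegral_norm_rpow_scale (d := d) (s - d) (measurableSet_Iio (a := (1 : ℝ))) hR
  have e1 : {x : EuclideanSpace ℝ (Fin d) | ‖x‖ / R ∈ Set.Iio 1} = Metric.ball 0 R := by
    ext x; simp [div_lt_one hR]
  have e2 : {x : EuclideanSpace ℝ (Fin d) | ‖x‖ ∈ Set.Iio 1} = Metric.ball 0 1 := by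
    ext x; simp
  rw [e1, e2, ← hC, sub_add_cancel] at h
  rw [h, mul_comm]

theorem setLIntegral_compl_norm_rpow (hd : 0 < d) {s : ℝ} (hs : 0 < s) :
    ∃ C : ℝ≥0, ∀ R : ℝ, 0 < R →
      ∫⁻ x in {x : EuclideanSpace ℝ (Fin d) | R < ‖x‖}, ‖x‖ₑ ^ (-s - d) ≤
        C * ENNReal.ofReal R ^ (-s) := by
  have := nontrivial_euclideanSpace hd
  have hm : MeasurableSet {x : EuclideanSpace ℝ (Fin d) | ‖x‖ ∈ Set.Ioi 1} :=
    measurable_norm measurableSet_Ioi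
  have hi : Integrable (fun x : EuclideanSpace ℝ (Fin d) => (Set.Ioi 1).indicator (fun y : ℝ => y ^ (-s - d)) ‖x‖) := by
    rw [integrable_fun_norm_addHaar volume]
    have h : IntegrableOn (fun y : ℝ => y ^ (-s - 1)) (Set.Ioi 1) :=
      (integrableOn_Ioi_rpow_iff one_pos).2 (by linarith)
    have h2 := ((integrable_indicator_iff measurableSet_Ioi).2 h).integrableOn (s := Set.Ioi 0)
    refine h2.congr_fun (fun y hy => ?_) measurableSet_Ioi
    simp only [smul_eq_mul, finrank_euclideanSpace_fin, Set.indicator_apply]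
    split_ifs
    · rw [← Real.rpow_natCast, ← Real.rpow_add hy, Nat.cast_sub hd]
      congr 1
      push_cast
      ring
    · simp
  have hfin : ∫⁻ x in {x : EuclideanSpace ℝ (Fin d) | ‖x‖ ∈ Set.Ioi 1}, ‖x‖ₑ ^ (-s - d) ≠ ∞ := by
    have h := hi.2
    rw [HasFiniteIntegral] at h
    refine (lt_of_le_of_lt (le_of_eq ?_) h).ne
    rw [← lintegral_indicator hm]
    refine lintegral_congr_ae ?_
    filter_upwards [ae_ne_zero hd] with x hx
    simp only [Set.indicator_apply, Set.mem_ofPred_eq]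
    split_ifs
    · rw [enorm_rpow_eq_enorm hx]
    · simp
  lift (∫⁻ x in {x : EuclideanSpace ℝ (Fin d) | ‖x‖ ∈ Set.Ioi 1}, ‖x‖ₑ ^ (-s - d)) to ℝ≥0 using hfin with C hC
  refine ⟨C, fun R hR => ?_⟩
  have h := setLIntegral_norm_rpow_scale (d := d) (-s - d) (measurableSet_Ioi (a := (1 : ℝ))) hR
  have e1 : {x : EuclideanSpace ℝ (Fin d) | ‖x‖ / R ∈ Set.Ioi 1} = {x : EuclideanSpace ℝ (Fin d) | R < ‖x‖} := by
    ext x; simp [one_lt_div hR]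
  rw [e1, ← hC, sub_add_cancel] at h
  rw [h, mul_comm]

/-! ### Truncation of functions in `L¹ ∩ L²` -/

/-- Measurable functions in `L^1 ∩ L^2`, on which the Fourier transform is an integral and
Plancherel's identity holds. -/
structure MemL1L2 (g : EuclideanSpace ℝ (Fin d) → ℂ) : Prop where
  measurable : Measurable g
  integrable : Integrable g
  memLp_two : MemLp g 2

namespace MemL1L2

variable {g : EuclideanSpace ℝ (Fin d) → ℂ}

theorem indicator (hg : MemL1L2 g) {S : Set (EuclideanSpace ℝ (Fin d))} (hS : MeasurableSet S) :
    MemL1L2 (S.indicator g) :=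
  ⟨hg.measurable.indicator hS, hg.integrable.indicator hS, hg.memLp_two.indicator hS⟩

theorem sub {h : EuclideanSpace ℝ (Fin d) → ℂ} (hg : MemL1L2 g) (hh : MemL1L2 h) :
    MemL1L2 (g - h) :=
  ⟨hg.measurable.sub hh.measurable, hg.integrable.sub hh.integrable,
    hg.memLp_two.sub hh.memLp_two⟩

theorem measurable_invFourier (hg : MemL1L2 g) : Measurable (invFourier g) :=
  (continuous_invFourier hg.integrable).measurable

/-- The part off `S` is given up to the trivial `L¹ → L^∞` bound, and the part on `S` is kept for a
finer estimate. Every splitting argument below starts here. -/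
theorem enorm_invFourier_le_add (hg : MemL1L2 g) {S : Set (EuclideanSpace ℝ (Fin d))}
    (hS : MeasurableSet S) (x : EuclideanSpace ℝ (Fin d)) :
    ‖invFourier g x‖ₑ ≤ ‖invFourier (S.indicator g) x‖ₑ + ∫⁻ ξ in Sᶜ, ‖g ξ‖ₑ := by
  have h : g = S.indicator g + Sᶜ.indicator g := (Set.indicator_self_add_compl S g).symm
  have h1 : invFourier g x = invFourier (S.indicator g) x + invFourier (Sᶜ.indicator g) x := by
    rw [← invFourier_add (hg.indicator hS).integrable (hg.indicator hS.compl).integrable, ← h]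
  rw [h1]
  refine (enorm_add_le _ _).trans ?_
  gcongr
  refine (enorm_invFourier_le _ _).trans (le_of_eq ?_)
  rw [← lintegral_indicator hS.compl]
  simp only [enorm_indicator_eq_indicator_enorm]

theorem lintegral_invFourier_indicator_sq (hg : MemL1L2 g) {S : Set (EuclideanSpace ℝ (Fin d))}
    (hS : MeasurableSet S) :
    ∫⁻ x, ‖invFourier (S.indicator g) x‖ₑ ^ (2 : ℝ) =
      ENNReal.ofReal ((2 * Real.pi) ^ d) * ∫⁻ ξ in S, ‖g ξ‖ₑ ^ (2 : ℝ) := by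
  rw [lintegral_invFourier_sq (hg.indicator hS).integrable (hg.indicator hS).memLp_two,
    ← lintegral_indicator hS]
  congr 2
  ext ξ
  by_cases h : ξ ∈ S <;> simp [h]

theorem lintegral_rpow_ne_top (hg : MemL1L2 g) {q : ℝ} (hq : 1 ≤ q) (hq2 : q ≤ 2) :
    ∫⁻ ξ, ‖g ξ‖ₑ ^ q ≠ ∞ := by
  have h1 : ∫⁻ ξ, ‖g ξ‖ₑ ≠ ∞ := hg.integrable.2.ne
  have h2 : ∫⁻ ξ, ‖g ξ‖ₑ ^ (2 : ℝ) ≠ ∞ := by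
    have := lintegral_rpow_enorm_lt_top_of_eLpNorm_lt_top (p := 2) (by simp) (by simp) hg.memLp_two.2
    simpa using this.ne
  refine ne_top_of_le_ne_top (ENNReal.add_ne_top.2 ⟨h1, h2⟩) ?_
  rw [← lintegral_add_left (by have := hg.measurable; fun_prop)]
  refine lintegral_mono fun ξ => ?_
  rcases le_total ‖g ξ‖ₑ 1 with h | h
  · exact (ENNReal.rpow_le_self_of_le_one h hq).trans le_self_add
  · exact (ENNReal.rpow_le_rpow_of_exponent_le h hq2).trans le_add_self

end MemL1L2

theorem invFourier_eq_zero_of_lintegral {g : EuclideanSpace ℝ (Fin d) → ℂ} (hg : MemL1L2 g)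
    {q : ℝ} (hq : 0 < q) (h : ∫⁻ ξ, ‖g ξ‖ₑ ^ q = 0) (x : EuclideanSpace ℝ (Fin d)) :
    invFourier g x = 0 := by
  have hm := hg.measurable
  rw [lintegral_eq_zero_iff (by fun_prop)] at h
  have h1 : ∫⁻ ξ, ‖g ξ‖ₑ = 0 := by
    rw [lintegral_eq_zero_iff (by fun_prop)]
    filter_upwards [h] with ξ hξ
    simpa [hq, hq.not_gt] using hξ
  have := enorm_invFourier_le g x
  rw [h1] at this
  simpa using this

/-! ### The inequalities of Hausdorff–Young, Paley and unweighted Pitt -/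

theorem meas_ofReal_le_le_lintegral_sq {α : Type*} [MeasurableSpace α] (μ : Measure α)
    {h : α → ℝ≥0∞} (hh : Measurable h) {t : ℝ} (ht : 0 < t) :
    μ {x | ENNReal.ofReal t ≤ h x} ≤
      ENNReal.ofReal (t ^ (-2 : ℝ)) * ∫⁻ x, h x ^ (2 : ℝ) ∂μ := by
  have hcheb := mul_meas_ge_le_lintegral (μ := μ) (f := fun x => h x ^ (2 : ℝ))
    (by fun_prop) (ENNReal.ofReal t ^ (2 : ℝ))
  simp only [ENNReal.rpow_le_rpow_iff two_pos] at hcheb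
  have h1 : ENNReal.ofReal (t ^ (-2 : ℝ)) * ENNReal.ofReal t ^ (2 : ℝ) = 1 := by
    rw [ENNReal.ofReal_rpow_of_pos ht, ← ENNReal.ofReal_mul (by positivity), ← Real.rpow_add ht]
    simp
  calc μ {x | ENNReal.ofReal t ≤ h x}
      = ENNReal.ofReal (t ^ (-2 : ℝ)) * (ENNReal.ofReal t ^ (2 : ℝ) *
          μ {x | ENNReal.ofReal t ≤ h x}) := by rw [← mul_assoc, h1, one_mul]
    _ ≤ _ := by gcongr

theorem le_ofReal_half_of_lt_add {t : ℝ} (ht : 0 < t) {a b c : ℝ≥0∞} (h : ENNReal.ofReal t < a)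
    (hab : a ≤ b + c) (hc : c ≤ ENNReal.ofReal (t / 2)) : ENNReal.ofReal (t / 2) ≤ b := by
  by_contra! hb
  have h4 : a < ENNReal.ofReal (t / 2) + ENNReal.ofReal (t / 2) :=
    hab.trans_lt (ENNReal.add_lt_add_of_lt_of_le (ne_top_of_le_ne_top ENNReal.ofReal_ne_top hc) hb hc)
  rw [← ENNReal.ofReal_add (by positivity) (by positivity), add_halves] at h4
  exact lt_asymm h h4

/-- The Hausdorff–Young inequality. -/
theorem hausdorffYoung {q q' : ℝ} (hqq' : q.HolderConjugate q') (hq2 : q < 2) :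
    ∃ C : ℝ≥0, ∀ g : EuclideanSpace ℝ (Fin d) → ℂ, MemL1L2 g →
      ∫⁻ x, ‖invFourier g x‖ₑ ^ q' ≤ C * (∫⁻ ξ, ‖g ξ‖ₑ ^ q) ^ (q' / q) := by
  have hq : 1 < q := hqq'.lt
  have hq'0 : 0 < q' := hqq'.symm.pos
  have hrel : (q - 1) * (q' - 1) = 1 := by
    have := hqq'.mul_eq_add; nlinarith
  have hq'2 : 0 < q' - 2 := by nlinarith
  have hdiv : q' / q = q' - 1 := by
    have := hqq'.mul_eq_add
    rw [div_eq_iff (by linarith)]; linarith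
  refine ⟨(q' * (4 * (2 * Real.pi) ^ d) * (1 / (q' - 2)) * 2 ^ (q' - 2)).toNNReal, fun g hg => ?_⟩
  have hm := hg.measurable
  set A := ∫⁻ ξ, ‖g ξ‖ₑ ^ q with hA
  have hAtop : A ≠ ∞ := hg.lintegral_rpow_ne_top hq.le hq2.le
  by_cases hA0 : A = 0
  · simp [invFourier_eq_zero_of_lintegral hg (by linarith) hA0, hq'0]
  set a := A.toReal with ha
  have ha0 : 0 < a := ENNReal.toReal_pos hA0 hAtop
  have hAa : A = ENNReal.ofReal a := (ENNReal.ofReal_toReal hAtop).symm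
  -- Where `g ≠ 0`, `M ξ` is the largest level `t` at which `ξ` still belongs to the low part `|g| ≤
  -- (2a/t)^{1/(q-1)}`. Integrating the `L²` norms of the low parts over `t` thus becomes a
  -- layer-cake formula for `M` with respect to `|g|² dξ`.
  set ν := (volume : Measure (EuclideanSpace ℝ (Fin d))).withDensity fun ξ => ‖g ξ‖ₑ ^ (2 : ℝ) with hν
  set M : EuclideanSpace ℝ (Fin d) → ℝ := fun ξ => 2 * a * ‖g ξ‖ ^ (-(q - 1)) with hM
  have hMm : Measurable M := by fun_prop
  have hdist : ∀ t : ℝ, 0 < t → volume {x | t < ‖invFourier g x‖} ≤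
      ENNReal.ofReal (4 * (2 * Real.pi) ^ d) * ENNReal.ofReal (t ^ (-2 : ℝ)) * ν {ξ | t ≤ M ξ} := by
    intro t ht
    -- On `|g| > s` one has `|g| ≤ s^{-(q-1)} |g|^q`; the height is chosen so that the integral of
    -- the right side is at most `(t/(2a)) · a = t/2`.
    set s := (2 * a / t) ^ (1 / (q - 1)) with hs
    have hs0 : 0 < s := by positivity
    set S := {ξ | ‖g ξ‖ ≤ s} with hS
    have hSm : MeasurableSet S := measurableSet_le hm.norm measurable_const
    have hspow : s ^ (-(q - 1)) = t / (2 * a) := by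
      rw [hs, ← Real.rpow_mul (by positivity), mul_neg, one_div, inv_mul_cancel₀ (by linarith),
        Real.rpow_neg_one, inv_div]
    have hhi : ∫⁻ ξ in Sᶜ, ‖g ξ‖ₑ ≤ ENNReal.ofReal (t / 2) := by
      have h1 : ∫⁻ ξ in Sᶜ, ‖g ξ‖ₑ ≤ ∫⁻ ξ in Sᶜ, ENNReal.ofReal (t / (2 * a)) * ‖g ξ‖ₑ ^ q := by
        refine setLIntegral_mono (by fun_prop) fun ξ hξ => ?_
        have hξ' : s < ‖g ξ‖ := by simpa [hS] using hξ
        have hpos : 0 < ‖g ξ‖ := hs0.trans hξ'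
        rw [← ofReal_norm, ENNReal.ofReal_rpow_of_pos hpos, ← ENNReal.ofReal_mul (by positivity)]
        refine ENNReal.ofReal_le_ofReal ?_
        rw [← hspow]
        have h2 : ‖g ξ‖ ^ (-(q - 1)) ≤ s ^ (-(q - 1)) :=
          Real.rpow_le_rpow_of_nonpos hs0 hξ'.le (by linarith)
        calc ‖g ξ‖ = ‖g ξ‖ ^ (-(q - 1)) * ‖g ξ‖ ^ q := by
              rw [← Real.rpow_add hpos, show -(q - 1) + q = 1 by ring, Real.rpow_one]
          _ ≤ _ := by gcongr
      refine h1.trans ((setLIntegral_le_lintegral _ _).trans ?_)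
      rw [lintegral_const_mul _ (by fun_prop), ← hA, hAa, ← ENNReal.ofReal_mul (by positivity)]
      refine ENNReal.ofReal_le_ofReal (le_of_eq ?_)
      field_simp
    have hsub : {x | t < ‖invFourier g x‖} ⊆
        {x | ENNReal.ofReal (t / 2) ≤ ‖invFourier (S.indicator g) x‖ₑ} := by
      intro x hx
      refine le_ofReal_half_of_lt_add ht ?_ (hg.enorm_invFourier_le_add hSm x) hhi
      rw [← ofReal_norm]
      exact (ENNReal.ofReal_lt_ofReal_iff_of_nonneg ht.le).2 hx
    have hcheb := meas_ofReal_le_le_lintegral_sq volume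
      (h := fun x => ‖invFourier (S.indicator g) x‖ₑ)
      (by have := (hg.indicator hSm).measurable_invFourier; fun_prop) (half_pos ht)
    rw [hg.lintegral_invFourier_indicator_sq hSm] at hcheb
    have hνS : ∫⁻ ξ in S, ‖g ξ‖ₑ ^ (2 : ℝ) ≤ ν {ξ | t ≤ M ξ} := by
      rw [hν, withDensity_apply _ (measurableSet_le measurable_const hMm), ← lintegral_indicator hSm,
        ← lintegral_indicator (measurableSet_le measurable_const hMm)]
      refine lintegral_mono fun ξ => ?_
      by_cases h0 : g ξ = 0
      · classical
        simp [Set.indicator_apply, h0]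
      · have hpos : 0 < ‖g ξ‖ := norm_pos_iff.2 h0
        by_cases hξ : ξ ∈ S
        swap
        · rw [Set.indicator_of_notMem hξ]; exact zero_le
        have hξ' : t ≤ M ξ := by
          have h2 : s ^ (-(q - 1)) ≤ ‖g ξ‖ ^ (-(q - 1)) :=
            Real.rpow_le_rpow_of_nonpos hpos hξ (by linarith)
          rw [hspow, div_le_iff₀ (by positivity)] at h2
          simpa only [hM, mul_comm] using h2
        rw [Set.indicator_of_mem hξ, Set.indicator_of_mem (show ξ ∈ {ξ | t ≤ M ξ} from hξ')]
    calc volume {x | t < ‖invFourier g x‖}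
        ≤ ENNReal.ofReal ((t / 2) ^ (-2 : ℝ)) * (ENNReal.ofReal ((2 * Real.pi) ^ d) * ν {ξ | t ≤ M ξ}) :=
          (measure_mono hsub).trans (hcheb.trans (by gcongr))
      _ = _ := by
          rw [← mul_assoc, ← ENNReal.ofReal_mul (by positivity), ← ENNReal.ofReal_mul (by positivity)]
          congr 2
          rw [Real.div_rpow ht.le (by norm_num), Real.rpow_neg two_pos.le]
          norm_num
          ring
  have hlc := lintegral_rpow_eq_lintegral_meas_lt_mul (volume : Measure (EuclideanSpace ℝ (Fin d)))
    (f := fun x => ‖invFourier g x‖) (Eventually.of_forall fun x => norm_nonneg _)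
    (by have := hg.measurable_invFourier; fun_prop) hq'0
  have hlc2 := lintegral_rpow_eq_lintegral_meas_le_mul ν
    (f := M) (Eventually.of_forall fun x => by simp only [hM, Pi.zero_apply]; positivity)
    hMm.aemeasurable hq'2
  have hL : ∫⁻ x, ‖invFourier g x‖ₑ ^ q' = ∫⁻ x, ENNReal.ofReal (‖invFourier g x‖ ^ q') := by
    refine lintegral_congr fun x => ?_
    rw [← ofReal_norm, ENNReal.ofReal_rpow_of_nonneg (norm_nonneg _) hq'0.le]
  -- The exponents close up: `2 - (q-1)(q'-2) = q`, because `(q-1)(q'-1) = 1`.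
  have hR : ∫⁻ ξ, ENNReal.ofReal (M ξ ^ (q' - 2)) ∂ν = ENNReal.ofReal ((2 * a) ^ (q' - 2)) * A := by
    rw [hν, lintegral_withDensity_eq_lintegral_mul _ (by fun_prop) (by fun_prop), hA,
      ← lintegral_const_mul _ (by fun_prop)]
    refine lintegral_congr fun ξ => ?_
    rcases eq_or_ne (g ξ) 0 with h0 | h0
    · simp [h0, (by linarith : 0 < q)]
    have hpos : 0 < ‖g ξ‖ := norm_pos_iff.2 h0
    simp only [Pi.mul_apply, hM]
    rw [← ofReal_norm, ENNReal.ofReal_rpow_of_pos hpos, ENNReal.ofReal_rpow_of_pos hpos,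
      ← ENNReal.ofReal_mul (by positivity), ← ENNReal.ofReal_mul (by positivity),
      Real.mul_rpow (by positivity) (by positivity), ← Real.rpow_mul hpos.le, mul_left_comm,
      ← Real.rpow_add hpos]
    congr 3
    linarith
  rw [hL, hlc]
  calc ENNReal.ofReal q' * ∫⁻ t in Set.Ioi 0, volume {x | t < ‖invFourier g x‖} * ENNReal.ofReal (t ^ (q' - 1))
      ≤ ENNReal.ofReal q' * ∫⁻ t in Set.Ioi 0, ENNReal.ofReal (4 * (2 * Real.pi) ^ d) *
          (ν {ξ | t ≤ M ξ} * ENNReal.ofReal (t ^ (q' - 2 - 1))) := by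
        gcongr 1
        refine setLIntegral_mono' measurableSet_Ioi fun t ht => ?_
        rw [Set.mem_Ioi] at ht
        refine (mul_le_mul_left (hdist t ht) _).trans (le_of_eq ?_)
        have : t ^ (q' - 2 - 1) = t ^ (-2 : ℝ) * t ^ (q' - 1) := by
          rw [← Real.rpow_add ht]; congr 1; ring
        rw [this, ENNReal.ofReal_mul (p := t ^ (-2 : ℝ)) (by positivity)]
        ring
    _ = ENNReal.ofReal q' * (ENNReal.ofReal (4 * (2 * Real.pi) ^ d) * (ENNReal.ofReal (1 / (q' - 2)) *
          (ENNReal.ofReal (q' - 2) * ∫⁻ t in Set.Ioi 0, ν {ξ | t ≤ M ξ} * ENNReal.ofReal (t ^ (q' - 2 - 1))))) := by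
        rw [lintegral_const_mul' _ _ ENNReal.ofReal_ne_top, ← mul_assoc (ENNReal.ofReal (1 / (q' - 2))),
          ← ENNReal.ofReal_mul (by positivity), one_div_mul_cancel hq'2.ne', ENNReal.ofReal_one, one_mul]
    _ = _ := by
        rw [← hlc2, hR, hdiv, hAa, ENNReal.ofReal_rpow_of_pos ha0, ENNReal.ofNNReal_toNNReal,
          ← ENNReal.ofReal_mul (by positivity), ← ENNReal.ofReal_mul (by positivity),
          ← ENNReal.ofReal_mul (by positivity), ← ENNReal.ofReal_mul (by positivity),
          ← ENNReal.ofReal_mul (by positivity), Real.mul_rpow two_pos.le ha0.le,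
          show q' - 1 = q' - 2 + 1 by ring, Real.rpow_add_one ha0.ne']
        congr 1
        ring

theorem lintegral_Ici_rpow {a m : ℝ} (ha : a < -1) (hm : 0 < m) :
    ∫⁻ t in Set.Ioi 0, (if m ≤ t then ENNReal.ofReal (t ^ a) else 0) =
      ENNReal.ofReal (m ^ (a + 1) * (1 / (-(a + 1)))) := by
  have h1 : ∫⁻ t in Set.Ioi 0, (if m ≤ t then ENNReal.ofReal (t ^ a) else 0) =
      ∫⁻ t in Set.Ioi m, ENNReal.ofReal (t ^ a) := by
    rw [restrict_Ioi_eq_restrict_Ici (a := m), ← lintegral_indicator measurableSet_Ioi, ← lintegral_indicator measurableSet_Ici]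
    refine lintegral_congr fun t => ?_
    by_cases ht : m ≤ t
    · simp [ht, hm.trans_le ht]
    · simp [ht]
  rw [h1, ← ofReal_integral_eq_lintegral_ofReal (integrableOn_Ioi_rpow_of_lt ha hm),
    integral_Ioi_rpow_of_lt ha hm]
  · congr 1
    field_simp
  · filter_upwards [ae_restrict_mem measurableSet_Ioi] with t ht
    exact Real.rpow_nonneg (hm.trans ht).le _

/-- Paley's inequality. -/
theorem paley (hd : 0 < d) {q : ℝ} (hq : 1 < q) (hq2 : q < 2) :
    ∃ C : ℝ≥0, ∀ g : EuclideanSpace ℝ (Fin d) → ℂ, MemL1L2 g →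
      ∫⁻ x, ‖x‖ₑ ^ (d * (q - 2)) * ‖invFourier g x‖ₑ ^ q ≤ C * ∫⁻ ξ, ‖g ξ‖ₑ ^ q := by
  have hd' : (0 : ℝ) < d := by exact_mod_cast hd
  obtain ⟨C₀, hC₀⟩ := setLIntegral_compl_norm_rpow hd hd'
  set P := (2 * Real.pi) ^ d with hP
  refine ⟨(q * (2 * C₀ * (1 / (q - 1)) + 4 * P * (1 / (2 - q)))).toNNReal, fun g hg => ?_⟩
  have hm := hg.measurable
  have hTm := hg.measurable_invFourier
  -- Marcinkiewicz interpolation for `g ↦ |x|^d ǧ(x)` with respect to `|x|^{-2d} dx`. Type `(2,2)`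
  -- is Plancherel. Weak type `(1,1)` holds because `|ǧ| ≤ ‖g‖₁` and the set `|x|^d > λ` has measure
  -- `O(1/λ)`. At level `t` the function is cut at height `t` itself.
  set μ := (volume : Measure (EuclideanSpace ℝ (Fin d))).withDensity fun x => ‖x‖ₑ ^ (-(2 * d : ℝ)) with hμ
  set ν := (volume : Measure (EuclideanSpace ℝ (Fin d))).withDensity fun ξ => ‖g ξ‖ₑ with hν
  have hdist : ∀ t : ℝ, 0 < t → μ {x | t < ‖x‖ ^ (d : ℝ) * ‖invFourier g x‖} ≤
      ENNReal.ofReal (2 * C₀ * t⁻¹) * ν {ξ | t < ‖g ξ‖} +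
      ENNReal.ofReal (4 * P * t ^ (-2 : ℝ)) * ∫⁻ ξ in {ξ | ‖g ξ‖ ≤ t}, ‖g ξ‖ₑ ^ (2 : ℝ) := by
    intro t ht
    set S := {ξ | ‖g ξ‖ ≤ t} with hS
    have hSm : MeasurableSet S := measurableSet_le hm.norm measurable_const
    have hSc : Sᶜ = {ξ | t < ‖g ξ‖} := by ext ξ; simp [hS]
    set N := ∫⁻ ξ in Sᶜ, ‖g ξ‖ₑ with hN
    have hNν : N = ν {ξ | t < ‖g ξ‖} := by
      rw [hN, hν, withDensity_apply _ (measurableSet_lt measurable_const hm.norm), hSc]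
    have hNtop : N ≠ ∞ := ne_top_of_le_ne_top hg.integrable.2.ne (setLIntegral_le_lintegral _ _)
    have hsub : {x : EuclideanSpace ℝ (Fin d) | t < ‖x‖ ^ (d : ℝ) * ‖invFourier g x‖} ⊆
        {x | ENNReal.ofReal (t / 2) < ‖x‖ₑ ^ (d : ℝ) * N} ∪
        {x | ENNReal.ofReal (t / 2) ≤ ‖x‖ₑ ^ (d : ℝ) * ‖invFourier (S.indicator g) x‖ₑ} := by
      intro x hx
      by_cases hxN : ENNReal.ofReal (t / 2) < ‖x‖ₑ ^ (d : ℝ) * N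
      · exact Or.inl hxN
      refine Or.inr (le_ofReal_half_of_lt_add ht (a := ‖x‖ₑ ^ (d : ℝ) * ‖invFourier g x‖ₑ) ?_ ?_ (not_lt.1 hxN))
      · rw [← ofReal_norm, ← ofReal_norm, ENNReal.ofReal_rpow_of_nonneg (norm_nonneg _) hd'.le,
          ← ENNReal.ofReal_mul (by positivity)]
        exact (ENNReal.ofReal_lt_ofReal_iff_of_nonneg ht.le).2 hx
      · rw [← mul_add]
        exact mul_le_mul_right (hg.enorm_invFourier_le_add hSm x) _
    have h1 : μ {x | ENNReal.ofReal (t / 2) < ‖x‖ₑ ^ (d : ℝ) * N} ≤ ENNReal.ofReal (2 * C₀ * t⁻¹) * N := by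
      rcases eq_or_ne N 0 with h0 | h0
      · simp [h0]
      set n := N.toReal with hn
      have hn0 : 0 < n := ENNReal.toReal_pos h0 hNtop
      have hNn : N = ENNReal.ofReal n := (ENNReal.ofReal_toReal hNtop).symm
      have hset : {x : EuclideanSpace ℝ (Fin d) | ENNReal.ofReal (t / 2) < ‖x‖ₑ ^ (d : ℝ) * N} =
          {x | (t / (2 * n)) ^ (1 / (d : ℝ)) < ‖x‖} := by
        ext x
        simp only [Set.mem_ofPred_eq]
        rw [hNn, ← ofReal_norm, ENNReal.ofReal_rpow_of_nonneg (norm_nonneg _) hd'.le,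
          ← ENNReal.ofReal_mul (by positivity), ENNReal.ofReal_lt_ofReal_iff_of_nonneg (by positivity),
          one_div, Real.rpow_inv_lt_iff_of_pos (by positivity) (norm_nonneg _) hd',
          div_lt_iff₀ two_pos, div_lt_iff₀ (mul_pos two_pos hn0)]
        constructor <;> intro h <;> linarith
      rw [hset, hμ, withDensity_apply _ (measurableSet_lt measurable_const measurable_norm)]
      have h2 := hC₀ ((t / (2 * n)) ^ (1 / (d : ℝ))) (by positivity)
      rw [show -(2 * d : ℝ) = -(d : ℝ) - d by ring]
      refine h2.trans (le_of_eq ?_)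
      rw [ENNReal.ofReal_rpow_of_pos (by positivity), ← Real.rpow_mul (by positivity), mul_neg,
        one_div_mul_cancel hd'.ne', Real.rpow_neg_one, hNn, ← ENNReal.ofReal_mul (by positivity),
        ← ENNReal.ofReal_coe_nnreal, ← ENNReal.ofReal_mul (by positivity)]
      congr 1
      field_simp
    have h2 : μ {x | ENNReal.ofReal (t / 2) ≤ ‖x‖ₑ ^ (d : ℝ) * ‖invFourier (S.indicator g) x‖ₑ} ≤
        ENNReal.ofReal (4 * P * t ^ (-2 : ℝ)) * ∫⁻ ξ in S, ‖g ξ‖ₑ ^ (2 : ℝ) := by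
      have hTSm := (hg.indicator hSm).measurable_invFourier
      refine (meas_ofReal_le_le_lintegral_sq μ (by fun_prop) (half_pos ht)).trans ?_
      rw [hμ, lintegral_withDensity_eq_lintegral_mul _ (by fun_prop) (by fun_prop)]
      have h3 : ∫⁻ x, ((fun x : EuclideanSpace ℝ (Fin d) => ‖x‖ₑ ^ (-(2 * d : ℝ))) * fun x =>
          (‖x‖ₑ ^ (d : ℝ) * ‖invFourier (S.indicator g) x‖ₑ) ^ (2 : ℝ)) x =
          ∫⁻ x, ‖invFourier (S.indicator g) x‖ₑ ^ (2 : ℝ) := by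
        refine lintegral_congr_ae ?_
        filter_upwards [ae_ne_zero hd] with x hx
        simp only [Pi.mul_apply]
        rw [ENNReal.mul_rpow_of_nonneg _ _ two_pos.le, ← ENNReal.rpow_mul, ← mul_assoc,
          ← ENNReal.rpow_add _ _ (by simpa using hx) enorm_ne_top, show -(2 * d : ℝ) + d * 2 = 0 by ring,
          ENNReal.rpow_zero, one_mul]
      rw [h3, hg.lintegral_invFourier_indicator_sq hSm, ← mul_assoc, ← ENNReal.ofReal_mul (by positivity)]
      refine le_of_eq ?_
      congr 2
      rw [Real.div_rpow ht.le (by norm_num), Real.rpow_neg two_pos.le]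
      norm_num
      ring
    rw [← hNν]
    exact (measure_mono hsub).trans ((measure_union_le _ _).trans (add_le_add h1 h2))
  have hlc := lintegral_rpow_eq_lintegral_meas_lt_mul μ
    (f := fun x => ‖x‖ ^ (d : ℝ) * ‖invFourier g x‖) (Eventually.of_forall fun x => by simp only [Pi.zero_apply]; positivity)
    (by fun_prop) (by linarith : 0 < q)
  have hlc2 := lintegral_rpow_eq_lintegral_meas_lt_mul ν
    (f := fun ξ => ‖g ξ‖) (Eventually.of_forall fun x => by simp only [Pi.zero_apply]; positivity)
    (by fun_prop) (by linarith : 0 < q - 1)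
  have hL : ∫⁻ x, ‖x‖ₑ ^ (d * (q - 2)) * ‖invFourier g x‖ₑ ^ q = ∫⁻ x, ENNReal.ofReal ((‖x‖ ^ (d : ℝ) * ‖invFourier g x‖) ^ q) ∂μ := by
    rw [hμ, lintegral_withDensity_eq_lintegral_mul _ (by fun_prop) (by fun_prop)]
    refine lintegral_congr_ae ?_
    filter_upwards [ae_ne_zero hd] with x hx
    simp only [Pi.mul_apply]
    rw [← ENNReal.ofReal_rpow_of_nonneg (by positivity) (by linarith), ENNReal.ofReal_mul (by positivity),
      ← ENNReal.ofReal_rpow_of_nonneg (norm_nonneg _) hd'.le, ofReal_norm, ofReal_norm,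
      ENNReal.mul_rpow_of_nonneg _ _ (by linarith), ← ENNReal.rpow_mul, ← mul_assoc,
      ← ENNReal.rpow_add _ _ (by simpa using hx) enorm_ne_top]
    congr 2
    ring
  have hhi : ∫⁻ ξ, ENNReal.ofReal (‖g ξ‖ ^ (q - 1)) ∂ν = ∫⁻ ξ, ‖g ξ‖ₑ ^ q := by
    rw [hν, lintegral_withDensity_eq_lintegral_mul _ (by fun_prop) (by fun_prop)]
    refine lintegral_congr fun ξ => ?_
    simp only [Pi.mul_apply]
    rw [← ENNReal.ofReal_rpow_of_nonneg (norm_nonneg _) (by linarith), ofReal_norm]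
    nth_rewrite 1 [← ENNReal.rpow_one ‖g ξ‖ₑ]
    rw [← ENNReal.rpow_add_of_nonneg _ _ zero_le_one (by linarith), add_sub_cancel]
  -- After Tonelli the inner integral is `∫_{|g|}^∞ t^{q-3} dt = |g|^{q-2}/(2-q)`, which converges
  -- because `q < 2`.
  have hlo : ∫⁻ t in Set.Ioi 0, (∫⁻ ξ in {ξ | ‖g ξ‖ ≤ t}, ‖g ξ‖ₑ ^ (2 : ℝ)) * ENNReal.ofReal (t ^ (q - 3)) =
      ENNReal.ofReal (1 / (2 - q)) * ∫⁻ ξ, ‖g ξ‖ₑ ^ q := by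
    have h1 : ∀ t : ℝ, (∫⁻ ξ in {ξ | ‖g ξ‖ ≤ t}, ‖g ξ‖ₑ ^ (2 : ℝ)) * ENNReal.ofReal (t ^ (q - 3)) =
        ∫⁻ ξ, ‖g ξ‖ₑ ^ (2 : ℝ) * (if ‖g ξ‖ ≤ t then ENNReal.ofReal (t ^ (q - 3)) else 0) := by
      intro t
      rw [← lintegral_indicator (measurableSet_le hm.norm measurable_const), ← lintegral_mul_const' _ _ ENNReal.ofReal_ne_top]
      refine lintegral_congr fun ξ => ?_
      by_cases h : ‖g ξ‖ ≤ t <;> simp [h]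
    simp only [h1]
    rw [lintegral_lintegral_swap, ← lintegral_const_mul _ (by fun_prop)]
    · refine lintegral_congr fun ξ => ?_
      rcases eq_or_ne (g ξ) 0 with h0 | h0
      · simp [h0, (by linarith : 0 < q)]
      have hpos : 0 < ‖g ξ‖ := norm_pos_iff.2 h0
      rw [lintegral_const_mul' _ _ (by simp), lintegral_Ici_rpow (by linarith) hpos, ← ofReal_norm,
        ENNReal.ofReal_rpow_of_pos hpos, ENNReal.ofReal_rpow_of_pos hpos, ← ENNReal.ofReal_mul (by positivity),
        ← ENNReal.ofReal_mul (by rw [one_div, inv_nonneg]; linarith), ← mul_assoc, ← Real.rpow_add hpos, mul_comm]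
      congr 3 <;> ring
    · refine Measurable.aemeasurable ?_
      refine Measurable.mul (by fun_prop) (Measurable.ite ?_ (by fun_prop) measurable_const)
      exact measurableSet_le (by fun_prop) (by fun_prop)
  rw [hL, hlc]
  calc ENNReal.ofReal q * ∫⁻ t in Set.Ioi 0, μ {x | t < ‖x‖ ^ (d : ℝ) * ‖invFourier g x‖} * ENNReal.ofReal (t ^ (q - 1))
      ≤ ENNReal.ofReal q * ∫⁻ t in Set.Ioi 0, (ENNReal.ofReal (2 * C₀) *
          (ν {ξ | t < ‖g ξ‖} * ENNReal.ofReal (t ^ (q - 1 - 1))) + ENNReal.ofReal (4 * P) *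
          ((∫⁻ ξ in {ξ | ‖g ξ‖ ≤ t}, ‖g ξ‖ₑ ^ (2 : ℝ)) * ENNReal.ofReal (t ^ (q - 3)))) := by
        gcongr 1
        refine setLIntegral_mono' measurableSet_Ioi fun t ht => ?_
        rw [Set.mem_Ioi] at ht
        refine (mul_le_mul_left (hdist t ht) _).trans (le_of_eq ?_)
        have e1 : t ^ (q - 1 - 1) = t⁻¹ * t ^ (q - 1) := by
          rw [← Real.rpow_neg_one, ← Real.rpow_add ht]; congr 1; ring
        have e2 : t ^ (q - 3) = t ^ (-2 : ℝ) * t ^ (q - 1) := by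
          rw [← Real.rpow_add ht]; congr 1; ring
        rw [e1, e2, ENNReal.ofReal_mul (p := t ^ (-2 : ℝ)) (by positivity),
          ENNReal.ofReal_mul (p := t⁻¹) (by positivity), ENNReal.ofReal_mul (p := 4 * P) (by positivity),
          ENNReal.ofReal_mul (p := 2 * C₀) (by positivity)]
        ring
    _ = ENNReal.ofReal q * (ENNReal.ofReal (2 * C₀) * (ENNReal.ofReal (1 / (q - 1)) *
          (ENNReal.ofReal (q - 1) * ∫⁻ t in Set.Ioi 0, ν {ξ | t < ‖g ξ‖} * ENNReal.ofReal (t ^ (q - 1 - 1)))) +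
          ENNReal.ofReal (4 * P) * ∫⁻ t in Set.Ioi 0, ((∫⁻ ξ in {ξ | ‖g ξ‖ ≤ t}, ‖g ξ‖ₑ ^ (2 : ℝ)) * ENNReal.ofReal (t ^ (q - 3)))) := by
        rw [lintegral_add_left, lintegral_const_mul' _ _ ENNReal.ofReal_ne_top, lintegral_const_mul' _ _ ENNReal.ofReal_ne_top,
          ← mul_assoc (ENNReal.ofReal (1 / (q - 1))), ← ENNReal.ofReal_mul (by rw [one_div, inv_nonneg]; linarith),
          one_div_mul_cancel (by linarith), ENNReal.ofReal_one, one_mul]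
        have : Measurable fun t => ν {ξ | t < ‖g ξ‖} :=
          Antitone.measurable fun s t hst => measure_mono fun ξ hξ => lt_of_le_of_lt hst hξ
        exact (this.mul (by fun_prop)).const_mul _
    _ = _ := by
        have h1 : 0 < q - 1 := by linarith
        have h2 : 0 < 2 - q := by linarith
        rw [← hlc2, hhi, hlo, ENNReal.ofNNReal_toNNReal, ← mul_assoc, ← mul_assoc, ← ENNReal.ofReal_mul (by positivity),
          ← ENNReal.ofReal_mul (by positivity), ← add_mul, ← ENNReal.ofReal_add (by positivity) (by positivity),
          ← mul_assoc, ← ENNReal.ofReal_mul (by positivity)]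

/-- The unweighted Pitt inequality, interpolated between the inequalities of Paley and
Hausdorff–Young. -/
theorem pitt_unweighted (hd : 0 < d) {q q' r : ℝ} (hqq' : q.HolderConjugate q') (hqr : q ≤ r)
    (hrq' : r ≤ q') :
    ∃ C : ℝ≥0, ∀ g : EuclideanSpace ℝ (Fin d) → ℂ, MemL1L2 g →
      ∫⁻ x, ‖x‖ₑ ^ (d * (r / q' - 1)) * ‖invFourier g x‖ₑ ^ r ≤ C * (∫⁻ ξ, ‖g ξ‖ₑ ^ q) ^ (r / q) := by
  have hq : 1 < q := hqq'.lt
  have hq'0 : 0 < q' := hqq'.symm.pos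
  have hmul := hqq'.mul_eq_add
  rcases lt_or_ge q 2 with hq2 | hq2
  · have hlt : q < q' := by nlinarith
    obtain ⟨C₁, hC₁⟩ := paley hd hq hq2
    obtain ⟨C₂, hC₂⟩ := hausdorffYoung (d := d) hqq' hq2
    -- Paley's exponent `d(q-2) = d(q/q'-1)` and the Hausdorff–Young exponent `0 = d(q'/q'-1)` are
    -- both values of `s ↦ d(s/q'-1)`. Hence the `θ` with `θq + (1-θ)q' = r` also produces the right
    -- power of `|x|`.
    set θ := (q' - r) / (q' - q) with hθ
    have hθ0 : 0 ≤ θ := div_nonneg (by linarith) (by linarith)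
    have hθ1 : 0 ≤ 1 - θ := by
      rw [hθ, sub_nonneg, div_le_one (by linarith)]; linarith
    have hr : θ * q + (1 - θ) * q' = r := by
      rw [hθ]; field_simp [(by linarith : q' - q ≠ 0)]; ring
    refine ⟨C₁ ^ θ * C₂ ^ (1 - θ), fun g hg => ?_⟩
    have hTm := hg.measurable_invFourier
    have h1 : ∫⁻ x, ‖x‖ₑ ^ (d * (r / q' - 1)) * ‖invFourier g x‖ₑ ^ r =
        ∫⁻ x, (‖x‖ₑ ^ (d * (q - 2)) * ‖invFourier g x‖ₑ ^ q) ^ θ * (‖invFourier g x‖ₑ ^ q') ^ (1 - θ) := by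
      refine lintegral_congr_ae ?_
      filter_upwards [ae_ne_zero hd] with x hx
      rw [ENNReal.mul_rpow_of_nonneg _ _ hθ0, ← ENNReal.rpow_mul, ← ENNReal.rpow_mul, ← ENNReal.rpow_mul,
        mul_assoc, ← ENNReal.rpow_add_of_nonneg _ _ (by positivity) (by positivity), mul_comm q, mul_comm q' (1 - θ), hr]
      congr 2
      have : q - 2 = q / q' - 1 := by field_simp; linarith
      rw [this, ← hr]
      field_simp
      ring
    rw [h1]
    refine (ENNReal.lintegral_mul_norm_pow_le (by fun_prop) (by fun_prop) hθ0 hθ1 (by ring)).trans ?_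
    calc _ ≤ (C₁ * ∫⁻ ξ, ‖g ξ‖ₑ ^ q) ^ θ * (C₂ * (∫⁻ ξ, ‖g ξ‖ₑ ^ q) ^ (q' / q)) ^ (1 - θ) :=
          mul_le_mul' (ENNReal.rpow_le_rpow (hC₁ g hg) hθ0) (ENNReal.rpow_le_rpow (hC₂ g hg) hθ1)
      _ = _ := by
          rw [ENNReal.mul_rpow_of_nonneg _ _ hθ0, ENNReal.mul_rpow_of_nonneg _ _ hθ1, ← ENNReal.rpow_mul,
            mul_mul_mul_comm, ← ENNReal.rpow_add_of_nonneg _ _ hθ0 (by positivity), ENNReal.coe_mul,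
            ENNReal.coe_rpow_of_nonneg _ hθ0, ENNReal.coe_rpow_of_nonneg _ hθ1, ← hr]
          congr 2
          field_simp
  -- Since `q ≤ r ≤ q'`, this case forces `q = r = q' = 2` and is Plancherel.
  · have hq'2 : q' = 2 := by nlinarith
    have hq2' : q = 2 := by nlinarith
    have hr2 : r = 2 := by linarith
    subst hq'2 hq2' hr2
    refine ⟨((2 * Real.pi) ^ d).toNNReal, fun g hg => ?_⟩
    simp only [div_self (two_ne_zero' ℝ), sub_self, mul_zero, ENNReal.rpow_zero, one_mul, ENNReal.rpow_one]
    rw [lintegral_invFourier_sq hg.integrable hg.memLp_two]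
    rfl

/-! ### Radial weights: reverse doubling and a gain of a power -/

theorem ennreal_rpow_le_rpow_of_nonpos {a b : ℝ≥0∞} {z : ℝ} (hz : z ≤ 0) (h : a ≤ b) :
    b ^ z ≤ a ^ z := by
  rw [← neg_neg z, ENNReal.rpow_neg, ENNReal.rpow_neg a]
  exact ENNReal.inv_le_inv.2 (ENNReal.rpow_le_rpow h (by linarith))

/-- A radial non-decreasing weight `w(|ξ|)` on `ℝ^d` for which the mean of `w^{-q'}` over a ball
around the origin is comparable to its value on the boundary. -/
structure IsRadialWeight (d : ℕ) (q' : ℝ) (D : ℝ≥0) (w : ℝ → ℝ≥0∞) : Prop where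
  mono : Monotone w
  ne_zero : ∀ t, 0 < t → w t ≠ 0
  ne_top : ∀ t, w t ≠ ∞
  lintegral_le : ∀ R : ℝ, 0 < R →
    ∫⁻ ξ in Metric.closedBall (0 : EuclideanSpace ℝ (Fin d)) R, w ‖ξ‖ ^ (-q') ≤
      D * ENNReal.ofReal R ^ (d : ℝ) * w R ^ (-q')

theorem volume_ball_le_volume_annulus (hd : 0 < d) {R : ℝ} (hR : 0 < R) :
    ENNReal.ofReal R ^ (d : ℝ) * volume (Metric.ball (0 : EuclideanSpace ℝ (Fin d)) 1) ≤
      volume (Metric.closedBall (0 : EuclideanSpace ℝ (Fin d)) (2 * R) \ Metric.closedBall 0 R) := by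
  have hRd : ENNReal.ofReal R ^ (d : ℝ) = ENNReal.ofReal (R ^ d) := by
    rw [ENNReal.ofReal_rpow_of_pos hR, Real.rpow_natCast]
  rw [measure_sdiff (Metric.closedBall_subset_closedBall (by linarith))
    measurableSet_closedBall.nullMeasurableSet measure_closedBall_lt_top.ne,
    Measure.addHaar_closedBall _ _ (by positivity), Measure.addHaar_closedBall _ _ hR.le, hRd,
    finrank_euclideanSpace_fin]
  refine ENNReal.le_sub_of_add_le_left (ENNReal.mul_ne_top ENNReal.ofReal_ne_top measure_ball_lt_top.ne) ?_
  rw [← add_mul, ← ENNReal.ofReal_add (by positivity) (by positivity)]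
  gcongr
  rw [mul_pow, ← two_mul]
  gcongr
  exact le_self_pow₀ one_le_two hd.ne'

namespace IsRadialWeight

variable {q' : ℝ} {D : ℝ≥0} {w : ℝ → ℝ≥0∞}

theorem lintegral_ne_top (hw : IsRadialWeight d q' D w) {R : ℝ} (hR : 0 < R) :
    ∫⁻ ξ in Metric.closedBall (0 : EuclideanSpace ℝ (Fin d)) R, w ‖ξ‖ ^ (-q') ≠ ∞ := by
  refine ne_top_of_le_ne_top ?_ (hw.lintegral_le R hR)
  have h0 := hw.ne_zero R hR
  have h1 := hw.ne_top R
  refine ENNReal.mul_ne_top (ENNReal.mul_ne_top ENNReal.coe_ne_top (by simp)) ?_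
  simp [ENNReal.rpow_eq_top_iff, h0, h1]

end IsRadialWeight

/-- Reverse doubling. On the annulus `R < |ξ| ≤ 2R` the weight is at most `w(2R)`, so the annulus
carries at least a multiple of `R^d w(2R)^{-q'}`. By `lintegral_le` this is a fixed share `c` of the
integral over the larger ball, and `δ = 1 - c`. -/
theorem exists_lintegral_half_ball_le (hd : 0 < d) {q' : ℝ} (hq' : 0 < q') (D : ℝ≥0) :
    ∃ δ : ℝ≥0, δ < 1 ∧ ∀ w, IsRadialWeight d q' D w → ∀ R : ℝ, 0 < R →
      ∫⁻ ξ in Metric.closedBall (0 : EuclideanSpace ℝ (Fin d)) R, w ‖ξ‖ ^ (-q') ≤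
        δ * ∫⁻ ξ in Metric.closedBall (0 : EuclideanSpace ℝ (Fin d)) (2 * R), w ‖ξ‖ ^ (-q') := by
  have hB0 : volume (Metric.ball (0 : EuclideanSpace ℝ (Fin d)) 1) ≠ 0 :=
    (Metric.measure_ball_pos volume _ one_pos).ne'
  have hBt : volume (Metric.ball (0 : EuclideanSpace ℝ (Fin d)) 1) ≠ ∞ := measure_ball_lt_top.ne
  lift volume (Metric.ball (0 : EuclideanSpace ℝ (Fin d)) 1) to ℝ≥0 using hBt with b hb
  have hb0 : 0 < b := by simpa [pos_iff_ne_zero] using hB0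
  -- `D + 1` rather than `D` avoids division by zero.
  set c : ℝ≥0 := b / ((D + 1) * 2 ^ d) with hc
  have hc0 : 0 < c := by positivity
  refine ⟨1 - c, tsub_lt_self one_pos hc0, fun w hw R hR => ?_⟩
  have h2R : 0 < 2 * R := by positivity
  set V1 := ∫⁻ ξ in Metric.closedBall (0 : EuclideanSpace ℝ (Fin d)) R, w ‖ξ‖ ^ (-q') with hV1
  set V2 := ∫⁻ ξ in Metric.closedBall (0 : EuclideanSpace ℝ (Fin d)) (2 * R), w ‖ξ‖ ^ (-q') with hV2
  have hV2t : V2 ≠ ∞ := hw.lintegral_ne_top h2R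
  have hsplit : V1 + ∫⁻ ξ in Metric.closedBall (0 : EuclideanSpace ℝ (Fin d)) (2 * R) \ Metric.closedBall 0 R, w ‖ξ‖ ^ (-q') = V2 := by
    have h := lintegral_inter_add_sdiff (μ := volume) (fun ξ : EuclideanSpace ℝ (Fin d) => w ‖ξ‖ ^ (-q'))
      (Metric.closedBall (0 : EuclideanSpace ℝ (Fin d)) (2 * R)) (measurableSet_closedBall (x := (0 : EuclideanSpace ℝ (Fin d))) (ε := R))
    rwa [Set.inter_eq_right.2 (Metric.closedBall_subset_closedBall (by linarith))] at h
  have hann : ENNReal.ofReal R ^ (d : ℝ) * b * w (2 * R) ^ (-q') ≤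
      ∫⁻ ξ in Metric.closedBall (0 : EuclideanSpace ℝ (Fin d)) (2 * R) \ Metric.closedBall 0 R, w ‖ξ‖ ^ (-q') := by
    calc _ ≤ volume (Metric.closedBall (0 : EuclideanSpace ℝ (Fin d)) (2 * R) \ Metric.closedBall 0 R) * w (2 * R) ^ (-q') := by
          rw [hb]
          gcongr
          exact volume_ball_le_volume_annulus hd hR
      _ = ∫⁻ ξ in Metric.closedBall (0 : EuclideanSpace ℝ (Fin d)) (2 * R) \ Metric.closedBall 0 R, w (2 * R) ^ (-q') := by
          rw [setLIntegral_const, mul_comm]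
      _ ≤ _ := by
          refine setLIntegral_mono' (measurableSet_closedBall.diff measurableSet_closedBall) fun ξ hξ => ?_
          refine ennreal_rpow_le_rpow_of_nonpos (by linarith) (hw.mono ?_)
          simpa using hξ.1
  have hcV : c * V2 ≤ ENNReal.ofReal R ^ (d : ℝ) * b * w (2 * R) ^ (-q') := by
    calc (c : ℝ≥0∞) * V2 ≤ c * (D * ENNReal.ofReal (2 * R) ^ (d : ℝ) * w (2 * R) ^ (-q')) := by
          gcongr
          exact hw.lintegral_le _ h2R
      _ = ((c * (D * 2 ^ d) : ℝ≥0) : ℝ≥0∞) * ENNReal.ofReal R ^ (d : ℝ) * w (2 * R) ^ (-q') := by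
          rw [ENNReal.ofReal_mul two_pos.le, ENNReal.mul_rpow_of_nonneg _ _ (by positivity)]
          push_cast
          rw [ENNReal.rpow_natCast (ENNReal.ofReal 2), ENNReal.ofReal_ofNat]
          ring
      _ ≤ (b : ℝ≥0∞) * ENNReal.ofReal R ^ (d : ℝ) * w (2 * R) ^ (-q') := by
          gcongr
          rw [hc, div_mul_eq_mul_div, div_le_iff₀ (by positivity)]
          gcongr
          exact le_self_add
      _ = _ := by ring
  have hfin : V1 + c * V2 ≤ V2 := by
    calc V1 + c * V2 ≤ V1 + _ := add_le_add_right (hcV.trans hann) V1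
      _ = V2 := hsplit
  rw [ENNReal.coe_sub, ENNReal.coe_one, ENNReal.sub_mul (fun _ _ => hV2t), one_mul]
  exact ENNReal.le_sub_of_add_le_right (ENNReal.mul_ne_top ENNReal.coe_ne_top hV2t) hfin

/-- By reverse doubling the integral over the ball of radius `R/2^j` is at most `δ^j` times the
whole, while on the shell `R/2^{j+1} < |ξ| ≤ R/2^j` the new factor is at most `2^{γ(j+1)} R^{-γ}`.
The sum is geometric once `δ 2^γ < 1`. This gain makes the Hardy inequality work. -/
theorem exists_lintegral_rpow_norm_le (hd : 0 < d) {q' : ℝ} (hq' : 0 < q') (D : ℝ≥0) :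
    ∃ γ : ℝ, 0 < γ ∧ ∃ C : ℝ≥0, ∀ w, IsRadialWeight d q' D w → ∀ R : ℝ, 0 < R →
      ∫⁻ ξ in Metric.closedBall (0 : EuclideanSpace ℝ (Fin d)) R, w ‖ξ‖ ^ (-q') * ‖ξ‖ₑ ^ (-γ) ≤
        C * ENNReal.ofReal R ^ (d - γ) * w R ^ (-q') := by
  obtain ⟨δ, hδ1, hδ⟩ := exists_lintegral_half_ball_le hd hq' D
  -- As `γ → 0` the product tends to `δ < 1`. The choice depends on `δ` only, hence not on the
  -- individual weight.
  obtain ⟨γ, hγ0, hγ⟩ : ∃ γ : ℝ, 0 < γ ∧ δ * (2 : ℝ≥0) ^ γ < 1 := by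
    have hcont : Continuous fun γ : ℝ => (δ : ℝ) * (2 : ℝ) ^ γ := by
      fun_prop (disch := norm_num)
    have hev : ∀ᶠ γ in 𝓝 (0 : ℝ), (δ : ℝ) * (2 : ℝ) ^ γ < 1 :=
      hcont.continuousAt.eventually_lt_const (by simpa using hδ1)
    obtain ⟨γ, h1, h2⟩ := ((hev.filter_mono nhdsWithin_le_nhds).and (self_mem_nhdsWithin (s := Set.Ioi (0 : ℝ)))).exists
    refine ⟨γ, h2, ?_⟩
    exact_mod_cast h1
  set η := δ * (2 : ℝ≥0) ^ γ with hη
  refine ⟨γ, hγ0, (2 : ℝ≥0) ^ γ * (1 - η)⁻¹ * D, fun w hw R hR => ?_⟩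
  have hwm := hw.mono.measurable
  have hR0 : ENNReal.ofReal R ≠ 0 := by simpa using hR
  set V : ℝ → ℝ≥0∞ := fun R => ∫⁻ ξ in Metric.closedBall (0 : EuclideanSpace ℝ (Fin d)) R, w ‖ξ‖ ^ (-q') with hV
  have hVj : ∀ j : ℕ, V (R / 2 ^ j) ≤ (δ : ℝ≥0∞) ^ j * V R := by
    intro j
    induction j with
    | zero => simp
    | succ j ih =>
      have h := hδ w hw (R / 2 ^ (j + 1)) (by positivity)
      rw [show 2 * (R / 2 ^ (j + 1)) = R / 2 ^ j by rw [pow_succ]; field_simp] at h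
      refine h.trans ((mul_le_mul_right ih _).trans (le_of_eq ?_))
      rw [pow_succ]; ring
  -- Balls take the place of shells in the sum: only an upper bound is needed, and one term, that of
  -- the shell containing `ξ`, already suffices.
  have hpt : ∀ ξ : EuclideanSpace ℝ (Fin d), ξ ≠ 0 → ‖ξ‖ ≤ R → w ‖ξ‖ ^ (-q') * ‖ξ‖ₑ ^ (-γ) ≤
      ∑' j : ℕ, (Metric.closedBall (0 : EuclideanSpace ℝ (Fin d)) (R / 2 ^ j)).indicator
        (fun ξ => w ‖ξ‖ ^ (-q') * ENNReal.ofReal (R / 2 ^ (j + 1)) ^ (-γ)) ξ := by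
    intro ξ hξ hξR
    have hpos : 0 < ‖ξ‖ := norm_pos_iff.2 hξ
    obtain ⟨n, hn1, hn2⟩ := exists_nat_pow_near (x := R / ‖ξ‖) (y := 2) ((one_le_div hpos).2 hξR) one_lt_two
    refine le_trans ?_ (ENNReal.le_tsum n)
    rw [le_div_iff₀ hpos, mul_comm, ← le_div_iff₀ (by positivity)] at hn1
    rw [div_lt_iff₀ hpos, mul_comm, ← div_lt_iff₀ (by positivity)] at hn2
    rw [Set.indicator_of_mem (by simpa using hn1)]
    gcongr 1
    refine ennreal_rpow_le_rpow_of_nonpos (by linarith) ?_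
    rw [← ofReal_norm]
    exact ENNReal.ofReal_le_ofReal hn2.le
  calc ∫⁻ ξ in Metric.closedBall (0 : EuclideanSpace ℝ (Fin d)) R, w ‖ξ‖ ^ (-q') * ‖ξ‖ₑ ^ (-γ)
      ≤ ∫⁻ ξ, ∑' j : ℕ, (Metric.closedBall (0 : EuclideanSpace ℝ (Fin d)) (R / 2 ^ j)).indicator
        (fun ξ => w ‖ξ‖ ^ (-q') * ENNReal.ofReal (R / 2 ^ (j + 1)) ^ (-γ)) ξ := by
        rw [← lintegral_indicator measurableSet_closedBall]
        refine lintegral_mono_ae ?_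
        filter_upwards [ae_ne_zero hd] with ξ hξ
        by_cases h : ξ ∈ Metric.closedBall (0 : EuclideanSpace ℝ (Fin d)) R
        · rw [Set.indicator_of_mem h]
          exact hpt ξ hξ (by simpa using h)
        · rw [Set.indicator_of_notMem h]
          exact zero_le
    _ = ∑' j : ℕ, V (R / 2 ^ j) * ENNReal.ofReal (R / 2 ^ (j + 1)) ^ (-γ) := by
        rw [lintegral_tsum fun j => (Measurable.indicator (by fun_prop) measurableSet_closedBall).aemeasurable]
        congr 1
        ext j
        rw [lintegral_indicator measurableSet_closedBall, lintegral_mul_const _ (by fun_prop)]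
    _ ≤ ∑' j : ℕ, (V R * ENNReal.ofReal R ^ (-γ) * (2 : ℝ≥0∞) ^ γ) * (η : ℝ≥0∞) ^ j := by
        refine ENNReal.tsum_le_tsum fun j => (mul_le_mul_left (hVj j) _).trans (le_of_eq ?_)
        have h1 : ENNReal.ofReal (R / 2 ^ (j + 1)) ^ (-γ) =
            ENNReal.ofReal R ^ (-γ) * (2 : ℝ≥0∞) ^ γ * ((2 : ℝ≥0∞) ^ γ) ^ j := by
          rw [ENNReal.ofReal_div_of_pos (by positivity), ENNReal.div_eq_inv_mul, mul_comm,
            ENNReal.mul_rpow_of_ne_top ENNReal.ofReal_ne_top (by simp),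
            ENNReal.inv_rpow, ENNReal.rpow_neg, ENNReal.rpow_neg _ γ, inv_inv, ENNReal.ofReal_pow two_pos.le,
            ENNReal.ofReal_ofNat, ← ENNReal.rpow_natCast, ← ENNReal.rpow_mul, mul_assoc,
            ← ENNReal.rpow_natCast (2 ^ γ), ← ENNReal.rpow_mul, ← ENNReal.rpow_add _ _ (by simp) (by simp)]
          congr 2
          push_cast
          ring
        rw [h1, hη]
        push_cast
        rw [ENNReal.coe_rpow_of_nonneg _ hγ0.le, mul_pow]
        push_cast
        ring
    _ = V R * ENNReal.ofReal R ^ (-γ) * (2 : ℝ≥0∞) ^ γ * (1 - (η : ℝ≥0∞))⁻¹ := by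
        rw [ENNReal.tsum_mul_left, ENNReal.tsum_geometric]
    _ ≤ (D * ENNReal.ofReal R ^ (d : ℝ) * w R ^ (-q')) * ENNReal.ofReal R ^ (-γ) * (2 : ℝ≥0∞) ^ γ * (1 - (η : ℝ≥0∞))⁻¹ := by
        gcongr
        exact hw.lintegral_le R hR
    _ = _ := by
        have hη1 : 1 - η ≠ 0 := (tsub_pos_of_lt hγ).ne'
        rw [sub_eq_add_neg, ENNReal.rpow_add _ _ hR0 ENNReal.ofReal_ne_top]
        push_cast [ENNReal.coe_inv hη1]
        rw [ENNReal.coe_rpow_of_nonneg _ hγ0.le]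
        push_cast
        ring

/-! ### Weighted Hardy inequalities -/

theorem setLIntegral_closedBall_norm_rpow (hd : 0 < d) {s : ℝ} (hs : 0 < s) :
    ∃ C : ℝ≥0, ∀ R : ℝ, 0 < R →
      ∫⁻ x in Metric.closedBall (0 : EuclideanSpace ℝ (Fin d)) R, ‖x‖ₑ ^ (s - d) ≤
        C * ENNReal.ofReal R ^ s := by
  obtain ⟨C, hC⟩ := setLIntegral_ball_norm_rpow hd hs
  refine ⟨C * 2 ^ s, fun R hR => ?_⟩
  refine (lintegral_mono_set (Metric.closedBall_subset_ball (by linarith : R < 2 * R))).trans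
    ((hC (2 * R) (by positivity)).trans (le_of_eq ?_))
  rw [ENNReal.ofReal_mul two_pos.le, ENNReal.mul_rpow_of_nonneg _ _ hs.le, ENNReal.coe_mul,
    ENNReal.coe_rpow_of_nonneg _ hs.le, mul_assoc]
  simp

theorem measurable_setLIntegral_closedBall (G : EuclideanSpace ℝ (Fin d) → ℝ≥0∞) :
    Measurable fun R : ℝ => ∫⁻ ξ in Metric.closedBall (0 : EuclideanSpace ℝ (Fin d)) R, G ξ :=
  Monotone.measurable fun _ _ h => lintegral_mono_set (Metric.closedBall_subset_closedBall h)

/-- A weighted Hardy inequality, in the case of equal exponents. -/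
theorem hardy_diagonal (hd : 0 < d) {q q' : ℝ} (hqq' : q.HolderConjugate q') (D : ℝ≥0) :
    ∃ C : ℝ≥0, ∀ w, IsRadialWeight d q' D w → ∀ G : EuclideanSpace ℝ (Fin d) → ℝ≥0∞, Measurable G →
      ∫⁻ x : EuclideanSpace ℝ (Fin d), ‖x‖ₑ ^ (d * (q - 2)) * (w (1 / ‖x‖) *
        ∫⁻ ξ in Metric.closedBall (0 : EuclideanSpace ℝ (Fin d)) (1 / ‖x‖), G ξ) ^ q ≤
        C * ∫⁻ ξ, (w ‖ξ‖ * G ξ) ^ q := by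
  have hq : 1 < q := hqq'.lt
  have hq0 : 0 < q := hqq'.pos
  have hq'0 : 0 < q' := hqq'.symm.pos
  have hmul := hqq'.mul_eq_add
  obtain ⟨γ, hγ0, C₁, hC₁⟩ := exists_lintegral_rpow_norm_le hd hq'0 D
  -- Hölder is applied with the auxiliary factor `|ξ|^β`. The dual integrand is then `w^{-q'}
  -- |ξ|^{-γ}`, which `exists_lintegral_rpow_norm_le` controls.
  set β := γ / q' with hβ
  have hβ0 : 0 < β := by positivity
  have hβγ : β * q' = γ := by rw [hβ]; field_simp
  obtain ⟨C₂, hC₂⟩ := setLIntegral_closedBall_norm_rpow hd (mul_pos hβ0 hq0)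
  refine ⟨C₁ ^ (q - 1) * C₂, fun w hw G hG => ?_⟩
  have hwm := hw.mono.measurable
  set F : EuclideanSpace ℝ (Fin d) → ℝ≥0∞ := fun ξ => (w ‖ξ‖ * G ξ) ^ q * ‖ξ‖ₑ ^ (β * q) with hF
  have hFm : Measurable F := by fun_prop
  have hH : ∀ R : ℝ, 0 < R → (w R * ∫⁻ ξ in Metric.closedBall (0 : EuclideanSpace ℝ (Fin d)) R, G ξ) ^ q ≤
      (C₁ : ℝ≥0∞) ^ (q - 1) * ENNReal.ofReal R ^ (d * (q - 1) - β * q) *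
        ∫⁻ ξ in Metric.closedBall (0 : EuclideanSpace ℝ (Fin d)) R, F ξ := by
    intro R hR
    have hw0 := hw.ne_zero R hR
    have hwt := hw.ne_top R
    have h1 : ∫⁻ ξ in Metric.closedBall (0 : EuclideanSpace ℝ (Fin d)) R, G ξ ≤
        (∫⁻ ξ in Metric.closedBall (0 : EuclideanSpace ℝ (Fin d)) R, F ξ) ^ (1 / q) *
        (∫⁻ ξ in Metric.closedBall (0 : EuclideanSpace ℝ (Fin d)) R, w ‖ξ‖ ^ (-q') * ‖ξ‖ₑ ^ (-γ)) ^ (1 / q') := by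
      have h2 := ENNReal.lintegral_mul_le_Lp_mul_Lq (volume.restrict (Metric.closedBall (0 : EuclideanSpace ℝ (Fin d)) R)) hqq'
        (f := fun ξ => w ‖ξ‖ * G ξ * ‖ξ‖ₑ ^ β) (g := fun ξ => (w ‖ξ‖ * ‖ξ‖ₑ ^ β)⁻¹) (by fun_prop) (by fun_prop)
      refine le_trans (le_of_eq ?_) (h2.trans (le_of_eq ?_))
      · refine lintegral_congr_ae ?_
        filter_upwards [ae_restrict_of_ae (ae_ne_zero hd)] with ξ hξ
        have hpos : 0 < ‖ξ‖ := norm_pos_iff.2 hξ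
        have e0 : w ‖ξ‖ * ‖ξ‖ₑ ^ β ≠ 0 := mul_ne_zero (hw.ne_zero _ hpos) (by
          simp [ENNReal.rpow_eq_zero_iff, hξ])
        have et : w ‖ξ‖ * ‖ξ‖ₑ ^ β ≠ ∞ := ENNReal.mul_ne_top (hw.ne_top _)
          (ENNReal.rpow_ne_top_of_nonneg hβ0.le enorm_ne_top)
        simp only [Pi.mul_apply]
        rw [show w ‖ξ‖ * G ξ * ‖ξ‖ₑ ^ β = G ξ * (w ‖ξ‖ * ‖ξ‖ₑ ^ β) by ring, mul_assoc,
          ENNReal.mul_inv_cancel e0 et, mul_one]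
      · congr 2
        · refine lintegral_congr fun ξ => ?_
          rw [hF, ENNReal.mul_rpow_of_nonneg _ _ hq0.le, ← ENNReal.rpow_mul]
        · refine lintegral_congr_ae ?_
          filter_upwards [ae_restrict_of_ae (ae_ne_zero hd)] with ξ hξ
          have hpos : 0 < ‖ξ‖ := norm_pos_iff.2 hξ
          rw [ENNReal.inv_rpow, ← ENNReal.rpow_neg, ENNReal.mul_rpow_of_ne_zero (hw.ne_zero _ hpos)
            (by simp [ENNReal.rpow_eq_zero_iff, hξ]), ← ENNReal.rpow_mul, mul_neg, hβγ]
    have hqd : q / q' = q - 1 := by rw [div_eq_iff hq'0.ne']; linarith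
    calc (w R * ∫⁻ ξ in Metric.closedBall (0 : EuclideanSpace ℝ (Fin d)) R, G ξ) ^ q
        ≤ (w R * ((∫⁻ ξ in Metric.closedBall (0 : EuclideanSpace ℝ (Fin d)) R, F ξ) ^ (1 / q) *
          (C₁ * ENNReal.ofReal R ^ (d - γ) * w R ^ (-q')) ^ (1 / q'))) ^ q := by
          gcongr
          refine h1.trans ?_
          gcongr
          exact hC₁ w hw R hR
      _ = w R ^ q * ((∫⁻ ξ in Metric.closedBall (0 : EuclideanSpace ℝ (Fin d)) R, F ξ) *
          ((C₁ : ℝ≥0∞) ^ (q - 1) * ENNReal.ofReal R ^ (d * (q - 1) - β * q) * w R ^ (-q))) := by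
          rw [ENNReal.mul_rpow_of_nonneg _ _ hq0.le, ENNReal.mul_rpow_of_nonneg _ _ hq0.le,
            ← ENNReal.rpow_mul, ← ENNReal.rpow_mul, one_div_mul_cancel hq0.ne', ENNReal.rpow_one,
            show 1 / q' * q = q - 1 by rw [← hqd]; ring,
            ENNReal.mul_rpow_of_nonneg _ _ (by linarith), ENNReal.mul_rpow_of_nonneg _ _ (by linarith),
            ← ENNReal.rpow_mul, ← ENNReal.rpow_mul]
          congr 4
          · congr 1
            rw [← hβγ]
            linear_combination β * hmul.symm
          · linear_combination hmul.symm
      _ = _ := by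
          have : w R ^ q * w R ^ (-q) = 1 := by
            rw [← ENNReal.rpow_add _ _ hw0 hwt, add_neg_cancel, ENNReal.rpow_zero]
          rw [show ∀ a b c e f : ℝ≥0∞, a * (b * (c * e * f)) = (a * f) * (c * e * b) by intros; ring, this, one_mul]
  calc _ ≤ ∫⁻ x : EuclideanSpace ℝ (Fin d), (C₁ : ℝ≥0∞) ^ (q - 1) * (‖x‖ₑ ^ (β * q - d) *
        ∫⁻ ξ in Metric.closedBall (0 : EuclideanSpace ℝ (Fin d)) (1 / ‖x‖), F ξ) := by
        refine lintegral_mono_ae ?_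
        filter_upwards [ae_ne_zero hd] with x hx
        have hpos : 0 < ‖x‖ := norm_pos_iff.2 hx
        refine (mul_le_mul_right (hH (1 / ‖x‖) (by positivity)) _).trans (le_of_eq ?_)
        rw [one_div, ENNReal.ofReal_inv_of_pos hpos, ofReal_norm, ENNReal.inv_rpow, ← ENNReal.rpow_neg,
          show ∀ a b c e : ℝ≥0∞, a * (b * c * e) = b * ((a * c) * e) by intros; ring,
          ← ENNReal.rpow_add _ _ (by simpa using hx) enorm_ne_top]
        congr 3
        ring
    _ = (C₁ : ℝ≥0∞) ^ (q - 1) * ∫⁻ x : EuclideanSpace ℝ (Fin d), ∫⁻ ξ : EuclideanSpace ℝ (Fin d),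
        (if ‖x‖ * ‖ξ‖ ≤ 1 then ‖x‖ₑ ^ (β * q - d) * F ξ else 0) := by
        rw [lintegral_const_mul' _ _ (by simp [ENNReal.rpow_eq_top_iff]; intro; linarith)]
        congr 1
        refine lintegral_congr_ae ?_
        filter_upwards [ae_ne_zero hd] with x hx
        have hpos : 0 < ‖x‖ := norm_pos_iff.2 hx
        rw [← lintegral_indicator measurableSet_closedBall, ← lintegral_const_mul _ (hFm.indicator measurableSet_closedBall)]
        refine lintegral_congr fun ξ => ?_
        have : ξ ∈ Metric.closedBall (0 : EuclideanSpace ℝ (Fin d)) (1 / ‖x‖) ↔ ‖x‖ * ‖ξ‖ ≤ 1 := by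
          rw [mem_closedBall_zero_iff, le_div_iff₀ hpos, mul_comm]
        by_cases h : ‖x‖ * ‖ξ‖ ≤ 1
        · rw [if_pos h, Set.indicator_of_mem (this.2 h)]
        · rw [if_neg h, Set.indicator_of_notMem (fun hh => h (this.1 hh)), mul_zero]
    -- The region `|x||ξ| ≤ 1` is symmetric, so after Tonelli `x` ranges over the ball of radius
    -- `1/|ξ|`. There `|x|^{βq-d}` is integrable because `β > 0`, and its integral `O(|ξ|^{-βq})`
    -- cancels the power contained in `F`.
    _ = (C₁ : ℝ≥0∞) ^ (q - 1) * ∫⁻ ξ : EuclideanSpace ℝ (Fin d), ∫⁻ x : EuclideanSpace ℝ (Fin d),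
        (if ‖x‖ * ‖ξ‖ ≤ 1 then ‖x‖ₑ ^ (β * q - d) * F ξ else 0) := by
        congr 1
        refine lintegral_lintegral_swap (Measurable.aemeasurable ?_)
        refine Measurable.ite (measurableSet_le (by fun_prop) (by fun_prop)) (by fun_prop) measurable_const
    _ ≤ (C₁ : ℝ≥0∞) ^ (q - 1) * ∫⁻ ξ : EuclideanSpace ℝ (Fin d), C₂ * (w ‖ξ‖ * G ξ) ^ q := by
        gcongr 1
        refine lintegral_mono_ae ?_
        filter_upwards [ae_ne_zero hd] with ξ hξ
        have hpos : 0 < ‖ξ‖ := norm_pos_iff.2 hξ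
        have h1 : ∫⁻ x : EuclideanSpace ℝ (Fin d), (if ‖x‖ * ‖ξ‖ ≤ 1 then ‖x‖ₑ ^ (β * q - d) * F ξ else 0) =
            (∫⁻ x in Metric.closedBall (0 : EuclideanSpace ℝ (Fin d)) (1 / ‖ξ‖), ‖x‖ₑ ^ (β * q - d)) * F ξ := by
          rw [← lintegral_indicator measurableSet_closedBall, ← lintegral_mul_const _ (Measurable.indicator (by fun_prop) measurableSet_closedBall)]
          refine lintegral_congr fun x => ?_
          have : x ∈ Metric.closedBall (0 : EuclideanSpace ℝ (Fin d)) (1 / ‖ξ‖) ↔ ‖x‖ * ‖ξ‖ ≤ 1 := by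
            rw [mem_closedBall_zero_iff, le_div_iff₀ hpos]
          by_cases h : ‖x‖ * ‖ξ‖ ≤ 1
          · rw [if_pos h, Set.indicator_of_mem (this.2 h)]
          · rw [if_neg h, Set.indicator_of_notMem (fun hh => h (this.1 hh)), zero_mul]
        rw [h1]
        refine (mul_le_mul_left (hC₂ (1 / ‖ξ‖) (by positivity)) _).trans (le_of_eq ?_)
        rw [hF, one_div, ENNReal.ofReal_inv_of_pos hpos, ofReal_norm, ENNReal.inv_rpow, ← ENNReal.rpow_neg,
          show ∀ a b c e : ℝ≥0∞, a * b * (c * e) = a * ((b * e) * c) by intros; ring,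
          ← ENNReal.rpow_add _ _ (by simpa using hξ) enorm_ne_top, neg_add_cancel, ENNReal.rpow_zero, one_mul]
    _ = _ := by
        rw [lintegral_const_mul _ (by fun_prop), ENNReal.coe_mul, ENNReal.coe_rpow_of_nonneg _ (by linarith), mul_assoc]

/-- A weighted Hardy inequality. -/
theorem hardy (hd : 0 < d) {q q' r : ℝ} (hqq' : q.HolderConjugate q') (hqr : q ≤ r) (D : ℝ≥0) :
    ∃ C : ℝ≥0, ∀ w, IsRadialWeight d q' D w → ∀ G : EuclideanSpace ℝ (Fin d) → ℝ≥0∞, Measurable G →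
      ∫⁻ x : EuclideanSpace ℝ (Fin d), ‖x‖ₑ ^ (d * (r / q' - 1)) * (w (1 / ‖x‖) *
        ∫⁻ ξ in Metric.closedBall (0 : EuclideanSpace ℝ (Fin d)) (1 / ‖x‖), G ξ) ^ r ≤
        C * (∫⁻ ξ, (w ‖ξ‖ * G ξ) ^ q) ^ (r / q) := by
  have hq : 1 < q := hqq'.lt
  have hq0 : 0 < q := hqq'.pos
  have hq'0 : 0 < q' := hqq'.symm.pos
  have hmul := hqq'.mul_eq_add
  have hrq : 0 ≤ r - q := by linarith
  obtain ⟨C, hC⟩ := hardy_diagonal hd hqq' D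
  refine ⟨(D ^ (1 / q')) ^ (r - q) * C, fun w hw G hG => ?_⟩
  have hwm := hw.mono.measurable
  set A := ∫⁻ ξ, (w ‖ξ‖ * G ξ) ^ q with hA
  -- Hölder without an auxiliary power bounds `|x|^{d/q'} w(1/|x|) ∫ G` uniformly in `x`. The
  -- `(r-q)`-th power of this bound is pulled out of the integral, which leaves the case of equal
  -- exponents.
  have hH : ∀ R : ℝ, 0 < R → w R * ∫⁻ ξ in Metric.closedBall (0 : EuclideanSpace ℝ (Fin d)) R, G ξ ≤
      A ^ (1 / q) * (D : ℝ≥0∞) ^ (1 / q') * ENNReal.ofReal R ^ (d / q') := by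
    intro R hR
    have hw0 := hw.ne_zero R hR
    have hwt := hw.ne_top R
    have h1 : ∫⁻ ξ in Metric.closedBall (0 : EuclideanSpace ℝ (Fin d)) R, G ξ ≤
        A ^ (1 / q) * (D * ENNReal.ofReal R ^ (d : ℝ) * w R ^ (-q')) ^ (1 / q') := by
      have h2 := ENNReal.lintegral_mul_le_Lp_mul_Lq (volume.restrict (Metric.closedBall (0 : EuclideanSpace ℝ (Fin d)) R)) hqq'
        (f := fun ξ => w ‖ξ‖ * G ξ) (g := fun ξ => (w ‖ξ‖)⁻¹) (by fun_prop) (by fun_prop)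
      refine le_trans (le_of_eq ?_) (h2.trans ?_)
      · refine lintegral_congr_ae ?_
        filter_upwards [ae_restrict_of_ae (ae_ne_zero hd)] with ξ hξ
        have hpos : 0 < ‖ξ‖ := norm_pos_iff.2 hξ
        simp only [Pi.mul_apply]
        rw [mul_right_comm, ENNReal.mul_inv_cancel (hw.ne_zero _ hpos) (hw.ne_top _), one_mul]
      · gcongr
        · exact setLIntegral_le_lintegral _ _
        · simp only [ENNReal.inv_rpow, ← ENNReal.rpow_neg]
          exact hw.lintegral_le R hR
    refine (mul_le_mul_right h1 _).trans (le_of_eq ?_)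
    have : w R * w R ^ (-(1 : ℝ)) = 1 := by
      rw [ENNReal.rpow_neg_one, ENNReal.mul_inv_cancel hw0 hwt]
    rw [ENNReal.mul_rpow_of_nonneg _ _ (by positivity), ENNReal.mul_rpow_of_nonneg _ _ (by positivity),
      ← ENNReal.rpow_mul, ← ENNReal.rpow_mul, neg_mul, mul_one_div_cancel hq'0.ne', mul_one_div,
      show ∀ a b c e f : ℝ≥0∞, a * (b * (c * e * f)) = (a * f) * (b * c * e) by intros; ring, this, one_mul]
  calc _ ≤ ∫⁻ x : EuclideanSpace ℝ (Fin d), (A ^ (1 / q) * (D : ℝ≥0∞) ^ (1 / q')) ^ (r - q) *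
        (‖x‖ₑ ^ (d * (q - 2)) * (w (1 / ‖x‖) *
        ∫⁻ ξ in Metric.closedBall (0 : EuclideanSpace ℝ (Fin d)) (1 / ‖x‖), G ξ) ^ q) := by
        refine lintegral_mono_ae ?_
        filter_upwards [ae_ne_zero hd] with x hx
        have hpos : 0 < ‖x‖ := norm_pos_iff.2 hx
        have hx0 : ‖x‖ₑ ≠ 0 := by simpa using hx
        set Y := w (1 / ‖x‖) * ∫⁻ ξ in Metric.closedBall (0 : EuclideanSpace ℝ (Fin d)) (1 / ‖x‖), G ξ with hY
        have h1 : ‖x‖ₑ ^ (d / q') * Y ≤ A ^ (1 / q) * (D : ℝ≥0∞) ^ (1 / q') := by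
          refine (mul_le_mul_right (hH (1 / ‖x‖) (by positivity)) _).trans (le_of_eq ?_)
          rw [one_div ‖x‖, ENNReal.ofReal_inv_of_pos hpos, ofReal_norm, ENNReal.inv_rpow, ← ENNReal.rpow_neg,
            mul_left_comm, ← ENNReal.rpow_add _ _ hx0 enorm_ne_top, add_neg_cancel, ENNReal.rpow_zero, mul_one]
        have h2 : ‖x‖ₑ ^ (d * (r / q' - 1)) * Y ^ r =
            (‖x‖ₑ ^ (d / q') * Y) ^ (r - q) * (‖x‖ₑ ^ (d * (q - 2)) * Y ^ q) := by
          rw [ENNReal.mul_rpow_of_nonneg _ _ hrq, ← ENNReal.rpow_mul, mul_mul_mul_comm,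
            ← ENNReal.rpow_add _ _ hx0 enorm_ne_top, ← ENNReal.rpow_add_of_nonneg _ _ hrq hq0.le]
          congr 2
          · have hqd : q / q' = q - 1 := by rw [div_eq_iff hq'0.ne']; linarith
            linear_combination (d : ℝ) * hqd
          · ring
        rw [h2]
        gcongr
    _ = (A ^ (1 / q) * (D : ℝ≥0∞) ^ (1 / q')) ^ (r - q) * ∫⁻ x : EuclideanSpace ℝ (Fin d),
        (‖x‖ₑ ^ (d * (q - 2)) * (w (1 / ‖x‖) *
        ∫⁻ ξ in Metric.closedBall (0 : EuclideanSpace ℝ (Fin d)) (1 / ‖x‖), G ξ) ^ q) := by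
        refine lintegral_const_mul _ ?_
        exact Measurable.mul (by fun_prop) (Measurable.pow_const (Measurable.mul (by fun_prop)
          ((measurable_setLIntegral_closedBall G).comp (by fun_prop))) _)
    _ ≤ (A ^ (1 / q) * (D : ℝ≥0∞) ^ (1 / q')) ^ (r - q) * (C * A) := by
        gcongr
        exact hC w hw G hG
    _ = _ := by
        rw [ENNReal.mul_rpow_of_nonneg _ _ hrq, ← ENNReal.rpow_mul, ENNReal.coe_mul, 
          ENNReal.coe_rpow_of_nonneg _ hrq, ENNReal.coe_rpow_of_nonneg _ (by positivity)]
        have : A ^ (r / q) = A ^ (1 / q * (r - q)) * A := by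
          nth_rewrite 3 [← ENNReal.rpow_one A]
          rw [← ENNReal.rpow_add_of_nonneg _ _ (by positivity) zero_le_one]
          congr 1
          field_simp
          ring
        rw [this]
        ring

/-! ### The weighted Pitt inequality -/

theorem lintegral_superlevel_rpow_le {α : Type*} [MeasurableSpace α] (ν : Measure α)
    {W : α → ℝ} (hW : Measurable W) (hW0 : ∀ x, 0 ≤ W x) {q r : ℝ} (hq : 0 < q) (hqr : q ≤ r) :
    ∫⁻ t in Set.Ioi 0, ν {x | t < W x ^ r} ^ (r / q) ≤
      ENNReal.ofReal (r / q) * (∫⁻ x, ENNReal.ofReal (W x ^ q) ∂ν) ^ (r / q) := by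
  have hr : 0 < r := hq.trans_le hqr
  have hrq : 0 ≤ r / q - 1 := by rw [sub_nonneg, one_le_div hq]; exact hqr
  set A := ∫⁻ x, ENNReal.ofReal (W x ^ q) ∂ν with hA
  have hlc := lintegral_rpow_eq_lintegral_meas_lt_mul ν (f := fun x => W x ^ r)
    (Eventually.of_forall fun x => Real.rpow_nonneg (hW0 x) _) (by fun_prop) (div_pos hq hr)
  have hA2 : ∫⁻ x, ENNReal.ofReal ((W x ^ r) ^ (q / r)) ∂ν = A := by
    refine lintegral_congr fun x => ?_
    rw [← Real.rpow_mul (hW0 x), mul_div_cancel₀ _ hr.ne']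
  have hνm : Measurable fun t => ν {x | t < W x ^ r} :=
    Antitone.measurable fun s t hst => measure_mono fun x hx => lt_of_le_of_lt hst hx
  -- This is the embedding of `L^q` into the Lorentz space `L^{q,r}`. One factor `ν{W^r > t}` is
  -- kept; the remaining power `r/q - 1` is bounded by Chebyshev, and it supplies exactly the
  -- density `t^{q/r-1}` of the layer-cake formula.
  have hν : ∀ t : ℝ, 0 < t → ν {x | t < W x ^ r} ≤ ENNReal.ofReal (t ^ (-(q / r))) * A := by
    intro t ht
    have hm : MeasurableSet {x | t < W x ^ r} := measurableSet_lt measurable_const (by fun_prop)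
    calc ν {x | t < W x ^ r} = ∫⁻ x in {x | t < W x ^ r}, 1 ∂ν := by simp
      _ ≤ ∫⁻ x in {x | t < W x ^ r}, ENNReal.ofReal (t ^ (-(q / r))) * ENNReal.ofReal (W x ^ q) ∂ν := by
          refine setLIntegral_mono' hm fun x hx => ?_
          rw [← ENNReal.ofReal_mul (by positivity), ENNReal.one_le_ofReal]
          have h1 : t ^ (q / r) ≤ W x ^ q := by
            calc t ^ (q / r) ≤ (W x ^ r) ^ (q / r) :=
                  Real.rpow_le_rpow ht.le (le_of_lt hx) (by positivity)
              _ = W x ^ q := by rw [← Real.rpow_mul (hW0 x), mul_div_cancel₀ _ hr.ne']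
          rw [Real.rpow_neg ht.le, inv_mul_eq_div, one_le_div (by positivity)]
          exact h1
      _ ≤ _ := by
          refine (setLIntegral_le_lintegral _ _).trans (le_of_eq ?_)
          rw [lintegral_const_mul _ (by fun_prop)]
  calc ∫⁻ t in Set.Ioi 0, ν {x | t < W x ^ r} ^ (r / q)
      ≤ ∫⁻ t in Set.Ioi 0, (ν {x | t < W x ^ r} * ENNReal.ofReal (t ^ (q / r - 1))) * A ^ (r / q - 1) := by
        refine setLIntegral_mono' measurableSet_Ioi fun t ht => ?_
        rw [Set.mem_Ioi] at ht
        have h1 : ν {x | t < W x ^ r} ^ (r / q) = ν {x | t < W x ^ r} * ν {x | t < W x ^ r} ^ (r / q - 1) := by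
          nth_rewrite 2 [← ENNReal.rpow_one (ν {x | t < W x ^ r})]
          rw [← ENNReal.rpow_add_of_nonneg _ _ zero_le_one hrq, add_sub_cancel]
        rw [h1, mul_assoc]
        gcongr
        refine (ENNReal.rpow_le_rpow (hν t ht) hrq).trans (le_of_eq ?_)
        rw [ENNReal.mul_rpow_of_nonneg _ _ hrq, ENNReal.ofReal_rpow_of_pos (by positivity), ← Real.rpow_mul ht.le]
        congr 3
        field_simp
        ring
    _ = ENNReal.ofReal (r / q) * (ENNReal.ofReal (q / r) * ∫⁻ t in Set.Ioi 0, (ν {x | t < W x ^ r} * ENNReal.ofReal (t ^ (q / r - 1)))) * A ^ (r / q - 1) := by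
        have hm : Measurable fun t : ℝ => ν {x | t < W x ^ r} * ENNReal.ofReal (t ^ (q / r - 1)) :=
          hνm.mul (by fun_prop)
        rw [lintegral_mul_const _ hm, ← mul_assoc, ← ENNReal.ofReal_mul (by positivity)]
        rw [show r / q * (q / r) = 1 by field_simp, ENNReal.ofReal_one, one_mul]
    _ = ENNReal.ofReal (r / q) * A ^ (r / q) := by
        rw [← hlc, hA2, mul_assoc]
        congr 1
        nth_rewrite 1 [← ENNReal.rpow_one A]
        rw [← ENNReal.rpow_add_of_nonneg _ _ zero_le_one hrq, add_sub_cancel]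

/-- The weighted Pitt inequality for radial non-decreasing weights. -/
theorem pitt_weighted (hd : 0 < d) {q q' r : ℝ} (hqq' : q.HolderConjugate q') (hqr : q ≤ r)
    (hrq' : r ≤ q') (D : ℝ≥0) :
    ∃ C : ℝ≥0, ∀ w, IsRadialWeight d q' D w → ∀ g : EuclideanSpace ℝ (Fin d) → ℂ, MemL1L2 g →
      ∫⁻ x, ‖x‖ₑ ^ (d * (r / q' - 1)) * (w (1 / ‖x‖) * ‖invFourier g x‖ₑ) ^ r ≤
        C * (∫⁻ ξ, (w ‖ξ‖ * ‖g ξ‖ₑ) ^ q) ^ (r / q) := by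
  have hq : 1 < q := hqq'.lt
  have hq0 : 0 < q := hqq'.pos
  have hr0 : 0 < r := hq0.trans_le hqr
  have hr1 : 1 ≤ r := hq.le.trans hqr
  obtain ⟨C₁, hC₁⟩ := pitt_unweighted hd hqq' hqr hrq'
  obtain ⟨C₂, hC₂⟩ := hardy hd hqq' hqr D
  refine ⟨2 ^ (r - 1) * (C₁ * (r / q).toNNReal + C₂), fun w hw g hg => ?_⟩
  have hwm := hw.mono.measurable
  have hm := hg.measurable
  have hTm := hg.measurable_invFourier
  set H : ℝ → ℝ≥0∞ := fun R => ∫⁻ ξ in Metric.closedBall (0 : EuclideanSpace ℝ (Fin d)) R, ‖g ξ‖ₑ with hH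
  have hHm : Measurable H := measurable_setLIntegral_closedBall _
  set W : ℝ → ℝ := fun t => (w t).toReal with hW
  have hWm : Measurable W := by fun_prop
  have hW0 : ∀ t, 0 ≤ W t := fun t => ENNReal.toReal_nonneg
  have hWmono : Monotone W := fun s t hst => ENNReal.toReal_mono (hw.ne_top t) (hw.mono hst)
  have hWw : ∀ (t : ℝ) {a : ℝ}, 0 ≤ a → ENNReal.ofReal (W t ^ a) = w t ^ a := fun t a ha => by
    rw [← ENNReal.ofReal_rpow_of_nonneg (hW0 t) ha, ENNReal.ofReal_toReal (hw.ne_top t)]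
  -- With the weight removed from the measures, layer cake in the levels of `W(1/|x|)^r` reduces the
  -- claim to unweighted estimates on the sets `W(1/|x|)^r > t`. The part of `g` with `W(|ξ|)^r > t`
  -- is measured by `ν`, the rest by `μH`.
  set μ := (volume : Measure (EuclideanSpace ℝ (Fin d))).withDensity
    fun x => ‖x‖ₑ ^ (d * (r / q' - 1)) * ‖invFourier g x‖ₑ ^ r with hμ
  set μH := (volume : Measure (EuclideanSpace ℝ (Fin d))).withDensity
    fun x => ‖x‖ₑ ^ (d * (r / q' - 1)) * H (1 / ‖x‖) ^ r with hμH
  set ν := (volume : Measure (EuclideanSpace ℝ (Fin d))).withDensity fun ξ => ‖g ξ‖ₑ ^ q with hν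
  have hlcμ := lintegral_eq_lintegral_meas_lt μ (f := fun x => W (1 / ‖x‖) ^ r)
    (Eventually.of_forall fun x => Real.rpow_nonneg (hW0 _) _) (by fun_prop)
  have hlcH := lintegral_eq_lintegral_meas_lt μH (f := fun x => W (1 / ‖x‖) ^ r)
    (Eventually.of_forall fun x => Real.rpow_nonneg (hW0 _) _) (by fun_prop)
  have hdist : ∀ t : ℝ, 0 < t → μ {x | t < W (1 / ‖x‖) ^ r} ≤
      (2 : ℝ≥0∞) ^ (r - 1) * (C₁ * ν {ξ | t < W ‖ξ‖ ^ r} ^ (r / q) + μH {x | t < W (1 / ‖x‖) ^ r}) := by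
    intro t ht
    set S := {ξ : EuclideanSpace ℝ (Fin d) | t < W ‖ξ‖ ^ r} with hS
    set X := {x : EuclideanSpace ℝ (Fin d) | t < W (1 / ‖x‖) ^ r} with hX
    have hSm : MeasurableSet S := measurableSet_lt measurable_const (by fun_prop)
    have hXm : MeasurableSet X := measurableSet_lt measurable_const (by fun_prop)
    have hTSm := (hg.indicator hSm).measurable_invFourier
    have hνS : ν S = ∫⁻ ξ, ‖S.indicator g ξ‖ₑ ^ q := by
      rw [hν, withDensity_apply _ hSm, ← lintegral_indicator hSm]
      refine lintegral_congr fun ξ => ?_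
      by_cases h : ξ ∈ S <;> simp [h, hq0]
    rw [hμ, withDensity_apply _ hXm, hμH, withDensity_apply _ hXm, hνS]
    have hmul : ∀ x ∈ X, ‖x‖ₑ ^ (d * (r / q' - 1)) * ‖invFourier g x‖ₑ ^ r ≤
        (2 : ℝ≥0∞) ^ (r - 1) * (‖x‖ₑ ^ (d * (r / q' - 1)) * ‖invFourier (S.indicator g) x‖ₑ ^ r +
          ‖x‖ₑ ^ (d * (r / q' - 1)) * H (1 / ‖x‖) ^ r) := by
      intro x hx
      -- Here `W(|ξ|)^r ≤ t < W(1/|x|)^r`, and monotonicity of `W` excludes `|ξ| > 1/|x|`.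
      have h1 : ∫⁻ ξ in Sᶜ, ‖g ξ‖ₑ ≤ H (1 / ‖x‖) := by
        refine lintegral_mono_set fun ξ hξ => ?_
        rw [mem_closedBall_zero_iff]
        by_contra! hcon
        refine hξ (show t < W ‖ξ‖ ^ r from lt_of_lt_of_le hx ?_)
        exact Real.rpow_le_rpow (hW0 _) (hWmono hcon.le) hr0.le
      have h2 : ‖invFourier g x‖ₑ ^ r ≤ (2 : ℝ≥0∞) ^ (r - 1) * (‖invFourier (S.indicator g) x‖ₑ ^ r + H (1 / ‖x‖) ^ r) :=
        (ENNReal.rpow_le_rpow ((hg.enorm_invFourier_le_add hSm x).trans (add_le_add_right h1 _)) hr0.le).trans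
          (ENNReal.rpow_add_le_mul_rpow_add_rpow _ _ hr1)
      refine (mul_le_mul_right h2 _).trans (le_of_eq ?_)
      ring
    calc ∫⁻ x in X, ‖x‖ₑ ^ (d * (r / q' - 1)) * ‖invFourier g x‖ₑ ^ r
        ≤ ∫⁻ x in X, (2 : ℝ≥0∞) ^ (r - 1) * (‖x‖ₑ ^ (d * (r / q' - 1)) * ‖invFourier (S.indicator g) x‖ₑ ^ r +
          ‖x‖ₑ ^ (d * (r / q' - 1)) * H (1 / ‖x‖) ^ r) := setLIntegral_mono' hXm hmul
      _ = (2 : ℝ≥0∞) ^ (r - 1) * ((∫⁻ x in X, ‖x‖ₑ ^ (d * (r / q' - 1)) * ‖invFourier (S.indicator g) x‖ₑ ^ r) +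
          ∫⁻ x in X, ‖x‖ₑ ^ (d * (r / q' - 1)) * H (1 / ‖x‖) ^ r) := by
          rw [lintegral_const_mul _ (by fun_prop), lintegral_add_left (by fun_prop)]
      _ ≤ _ := by
          gcongr
          exact (setLIntegral_le_lintegral _ _).trans (hC₁ _ (hg.indicator hSm))
  have hL : ∫⁻ x, ‖x‖ₑ ^ (d * (r / q' - 1)) * (w (1 / ‖x‖) * ‖invFourier g x‖ₑ) ^ r =
      ∫⁻ x, ENNReal.ofReal (W (1 / ‖x‖) ^ r) ∂μ := by
    rw [hμ, lintegral_withDensity_eq_lintegral_mul _ (by fun_prop) (by fun_prop)]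
    refine lintegral_congr fun x => ?_
    simp only [Pi.mul_apply]
    rw [hWw _ hr0.le, ENNReal.mul_rpow_of_nonneg _ _ hr0.le]
    ring
  have hLH : ∫⁻ x, ENNReal.ofReal (W (1 / ‖x‖) ^ r) ∂μH ≤ C₂ * (∫⁻ ξ, (w ‖ξ‖ * ‖g ξ‖ₑ) ^ q) ^ (r / q) := by
    rw [hμH, lintegral_withDensity_eq_lintegral_mul _ (by fun_prop) (by fun_prop)]
    refine le_trans (le_of_eq ?_) (hC₂ w hw (fun ξ => ‖g ξ‖ₑ) (by fun_prop))
    refine lintegral_congr fun x => ?_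
    simp only [Pi.mul_apply]
    rw [hWw _ hr0.le, ENNReal.mul_rpow_of_nonneg _ _ hr0.le]
    ring
  have hLν : ∫⁻ ξ, ENNReal.ofReal (W ‖ξ‖ ^ q) ∂ν = ∫⁻ ξ, (w ‖ξ‖ * ‖g ξ‖ₑ) ^ q := by
    rw [hν, lintegral_withDensity_eq_lintegral_mul _ (by fun_prop) (by fun_prop)]
    refine lintegral_congr fun x => ?_
    simp only [Pi.mul_apply]
    rw [hWw _ hq0.le, ENNReal.mul_rpow_of_nonneg _ _ hq0.le, mul_comm]
  have hlev := lintegral_superlevel_rpow_le ν (W := fun ξ => W ‖ξ‖) (by fun_prop) (fun ξ => hW0 _) hq0 hqr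
  rw [hLν] at hlev
  have hνm : Measurable fun t => ν {ξ | t < W ‖ξ‖ ^ r} :=
    Antitone.measurable fun s t hst => measure_mono fun x hx => lt_of_le_of_lt hst hx
  rw [hL, hlcμ]
  calc ∫⁻ t in Set.Ioi 0, μ {x | t < W (1 / ‖x‖) ^ r}
      ≤ ∫⁻ t in Set.Ioi 0, (2 : ℝ≥0∞) ^ (r - 1) * (C₁ * ν {ξ | t < W ‖ξ‖ ^ r} ^ (r / q) + μH {x | t < W (1 / ‖x‖) ^ r}) :=
        setLIntegral_mono' measurableSet_Ioi hdist
    _ = (2 : ℝ≥0∞) ^ (r - 1) * (C₁ * (∫⁻ t in Set.Ioi 0, ν {ξ | t < W ‖ξ‖ ^ r} ^ (r / q)) +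
          ∫⁻ t in Set.Ioi 0, μH {x | t < W (1 / ‖x‖) ^ r}) := by
        rw [lintegral_const_mul' _ _ (by simp [ENNReal.rpow_eq_top_iff]), lintegral_add_left ((hνm.pow_const _).const_mul _),
          lintegral_const_mul _ (hνm.pow_const _)]
    _ ≤ (2 : ℝ≥0∞) ^ (r - 1) * (C₁ * (ENNReal.ofReal (r / q) * (∫⁻ ξ, (w ‖ξ‖ * ‖g ξ‖ₑ) ^ q) ^ (r / q)) +
          C₂ * (∫⁻ ξ, (w ‖ξ‖ * ‖g ξ‖ₑ) ^ q) ^ (r / q)) := by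
        rw [← hlcH]
        gcongr
    _ = _ := by
        rw [ENNReal.coe_mul, ENNReal.coe_add, ENNReal.coe_mul, ENNReal.coe_rpow_of_nonneg _ (by linarith)]
        rw [ENNReal.ofReal, ENNReal.coe_ofNat]
        ring

/-! ### From the class `A_q` to radial weights -/

theorem IsMuckenhoupt.pos_of_monotoneOn {q q' : ℝ} {K : ℝ≥0} {υ : ℝ → ℝ}
    (hmono : MonotoneOn υ (Set.Ici 0))
    (h : IsMuckenhoupt q q' K fun x : EuclideanSpace ℝ (Fin d) => υ ‖x‖) {t : ℝ} (ht : 0 < t) :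
    0 < υ t := by
  by_contra! hcon
  have h1 : Metric.ball (0 : EuclideanSpace ℝ (Fin d)) t ⊆ {x | ¬ 0 < υ ‖x‖} := by
    intro x hx
    rw [mem_ball_zero_iff] at hx
    exact not_lt.2 ((hmono (norm_nonneg x) ht.le hx.le).trans hcon)
  exact (Metric.measure_ball_pos volume _ ht).ne' (measure_mono_null h1 h.pos_ae)

/-- On the annulus `R < |x| ≤ 2R` one has `υ ≥ υ(R)`, so the integral of `υ` over the ball of radius
`3R` is at least `υ(R)|B_R|`. The `A_q` condition on that ball then bounds the integral of `υ^{1-q'}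
= w^{-q'}` by a multiple of `R^d υ(R)^{1-q'}`. Only balls about the origin are used. The maximum
with `0` makes `w` monotone on all of `ℝ`. -/
theorem IsMuckenhoupt.exists_isRadialWeight (hd : 0 < d) {q q' : ℝ} (hqq' : q.HolderConjugate q')
    (K : ℝ≥0) :
    ∃ D : ℝ≥0, ∀ υ : ℝ → ℝ, MonotoneOn υ (Set.Ici 0) →
      IsMuckenhoupt q q' K (fun x : EuclideanSpace ℝ (Fin d) => υ ‖x‖) →
      IsRadialWeight d q' D fun t => ENNReal.ofReal (υ (max t 0)) ^ (1 / q) := by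
  have hq0 : 0 < q := hqq'.pos
  have hq'0 : 0 < q' := hqq'.symm.pos
  have hmul := hqq'.mul_eq_add
  have hB0 : volume (Metric.ball (0 : EuclideanSpace ℝ (Fin d)) 1) ≠ 0 :=
    (Metric.measure_ball_pos volume _ one_pos).ne'
  have hBt : volume (Metric.ball (0 : EuclideanSpace ℝ (Fin d)) 1) ≠ ∞ := measure_ball_lt_top.ne
  set b := volume (Metric.ball (0 : EuclideanSpace ℝ (Fin d)) 1) with hb
  refine ⟨(K * 3 ^ d) ^ q' * b.toNNReal, fun υ hmono hυ => ⟨fun s t hst => ?_, fun t ht => ?_, fun t => ?_, fun R hR => ?_⟩⟩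
  · exact ENNReal.rpow_le_rpow (ENNReal.ofReal_le_ofReal
      (hmono (Set.mem_Ici.2 (le_max_right _ _)) (Set.mem_Ici.2 (le_max_right _ _)) (max_le_max_right _ hst))) (by positivity)
  · have := hυ.pos_of_monotoneOn hmono ht
    simp [ENNReal.rpow_eq_zero_iff, max_eq_left ht.le, hq0, not_le.2 this]
  · exact ENNReal.rpow_ne_top_of_nonneg (by positivity) ENNReal.ofReal_ne_top
  have hυR : 0 < υ R := hυ.pos_of_monotoneOn hmono hR
  have hexp : ∀ u : ℝ≥0∞, (u ^ (1 / q)) ^ (-q') = u ^ (1 - q') := fun u => by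
    rw [← ENNReal.rpow_mul]
    congr 1
    field_simp
    linarith
  simp only [hexp, max_eq_left (norm_nonneg _), max_eq_left hR.le]
  set V := ∫⁻ ξ in Metric.closedBall (0 : EuclideanSpace ℝ (Fin d)) R, ENNReal.ofReal (υ ‖ξ‖) ^ (1 - q') with hV
  set u := ENNReal.ofReal (υ R) with hu
  have hu0 : u ≠ 0 := by simpa [hu] using hυR
  have hut : u ≠ ∞ := ENNReal.ofReal_ne_top
  set m := ENNReal.ofReal R ^ (d : ℝ) * b with hm
  have hRd0 : ENNReal.ofReal R ^ (d : ℝ) ≠ 0 := by simp [hR]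
  have hm0 : m ≠ 0 := mul_ne_zero hRd0 hB0
  have hmt : m ≠ ∞ := ENNReal.mul_ne_top (by simp) hBt
  have hball := hυ.ball_le 0 (3 * R) (by positivity)
  have hvol : volume (Metric.ball (0 : EuclideanSpace ℝ (Fin d)) (3 * R)) = 3 ^ d * m := by
    rw [Measure.addHaar_ball_of_pos _ _ (by positivity), finrank_euclideanSpace_fin, hm, mul_pow,
      ENNReal.ofReal_mul (by positivity), ENNReal.ofReal_pow hR.le, ENNReal.ofReal_pow (by norm_num),
      ENNReal.rpow_natCast, ENNReal.ofReal_ofNat, mul_assoc]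
  have hlow : u * m ≤ ∫⁻ x in Metric.ball (0 : EuclideanSpace ℝ (Fin d)) (3 * R), ENNReal.ofReal (υ ‖x‖) := by
    calc u * m ≤ u * volume (Metric.closedBall (0 : EuclideanSpace ℝ (Fin d)) (2 * R) \ Metric.closedBall 0 R) := by
          gcongr
          exact volume_ball_le_volume_annulus hd hR
      _ = ∫⁻ x in Metric.closedBall (0 : EuclideanSpace ℝ (Fin d)) (2 * R) \ Metric.closedBall 0 R, u := by
          rw [setLIntegral_const]
      _ ≤ ∫⁻ x in Metric.closedBall (0 : EuclideanSpace ℝ (Fin d)) (2 * R) \ Metric.closedBall 0 R, ENNReal.ofReal (υ ‖x‖) := by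
          refine setLIntegral_mono' (measurableSet_closedBall.diff measurableSet_closedBall) fun x hx => ?_
          refine ENNReal.ofReal_le_ofReal (hmono hR.le (norm_nonneg x) ?_)
          have := hx.2
          rw [mem_closedBall_zero_iff, not_le] at this
          exact this.le
      _ ≤ _ := lintegral_mono_set (Set.sdiff_subset.trans (Metric.closedBall_subset_ball (by linarith)))
  have hVle : V ≤ ∫⁻ x in Metric.ball (0 : EuclideanSpace ℝ (Fin d)) (3 * R), ENNReal.ofReal (υ ‖x‖) ^ (1 - q') :=
    lintegral_mono_set (Metric.closedBall_subset_ball (by linarith))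
  have h1 : (3 ^ d * m)⁻¹ * (u * m) ^ (1 / q) * V ^ (1 / q') ≤ K := by
    refine le_trans ?_ hball
    rw [hvol]
    gcongr
  have h2 : V ^ (1 / q') ≤ (K * 3 ^ d) * (m ^ (1 / q') * u ^ (-(1 / q))) := by
    have e1 : (K * 3 ^ d : ℝ≥0∞) * (m ^ (1 / q') * u ^ (-(1 / q))) = K * ((3 ^ d * m) * (u * m) ^ (-(1 / q))) := by
      rw [ENNReal.mul_rpow_of_ne_zero hu0 hm0, show 1 / q' = 1 + -(1 / q) by field_simp; linarith,
        ENNReal.rpow_add _ _ hm0 hmt, ENNReal.rpow_one]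
      ring
    have hum0 : u * m ≠ 0 := mul_ne_zero hu0 hm0
    have humt : u * m ≠ ∞ := ENNReal.mul_ne_top hut hmt
    have h3m0 : (3 ^ d * m) ≠ 0 := mul_ne_zero (by simp) hm0
    have h3mt : (3 ^ d * m) ≠ ∞ := ENNReal.mul_ne_top (by simp) hmt
    rw [e1]
    calc V ^ (1 / q') = ((3 ^ d * m)⁻¹ * (u * m) ^ (1 / q) * V ^ (1 / q')) * ((3 ^ d * m) * (u * m) ^ (-(1 / q))) := by
          have e2 : (3 ^ d * m)⁻¹ * (3 ^ d * m) = 1 := ENNReal.inv_mul_cancel h3m0 h3mt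
          have e3 : (u * m) ^ (1 / q) * (u * m) ^ (-(1 / q)) = 1 := by
            rw [← ENNReal.rpow_add _ _ hum0 humt, add_neg_cancel, ENNReal.rpow_zero]
          rw [show ∀ a b c e f : ℝ≥0∞, a * b * c * (e * f) = (a * e) * (b * f) * c by intros; ring, e2, e3, one_mul, one_mul]
      _ ≤ _ := by gcongr
  have h3 := ENNReal.rpow_le_rpow h2 hq'0.le
  rw [← ENNReal.rpow_mul, one_div_mul_cancel hq'0.ne', ENNReal.rpow_one] at h3
  refine h3.trans (le_of_eq ?_)
  rw [ENNReal.mul_rpow_of_nonneg _ _ hq'0.le, ENNReal.mul_rpow_of_nonneg (m ^ _) _ hq'0.le, ← ENNReal.rpow_mul, ← ENNReal.rpow_mul,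
    one_div_mul_cancel hq'0.ne', ENNReal.rpow_one, ENNReal.coe_mul, ENNReal.coe_rpow_of_nonneg _ hq'0.le,
    ENNReal.coe_toNNReal hBt, hm, show -(1 / q) * q' = 1 - q' by field_simp; linarith]
  push_cast
  ring

/-! ### Fourier inversion for test functions and symbols of derivatives -/

theorem fourierSym_eq_fourier (f : EuclideanSpace ℝ (Fin d) → ℂ) (ξ : EuclideanSpace ℝ (Fin d)) :
    fourierSym f ξ = (((2 * Real.pi) ^ (-((d : ℝ) / 2)) : ℝ) : ℂ) * 𝓕 f ((2 * Real.pi)⁻¹ • ξ) := by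
  rw [fourierSym_eq_invFourier, invFourier_eq_fourierInv, Real.fourierInv_eq_fourier_neg, smul_neg,
    neg_neg]

theorem two_pi_rpow_mul_self :
    (((2 * Real.pi) ^ (-((d : ℝ) / 2)) : ℝ) : ℂ) * (((2 * Real.pi) ^ (-((d : ℝ) / 2)) : ℝ) : ℂ) *
      (((2 * Real.pi) ^ d : ℝ) : ℂ) = 1 := by
  rw [← Complex.ofReal_mul, ← Complex.ofReal_mul, ← Real.rpow_add (by positivity),
    ← Real.rpow_natCast, ← Real.rpow_add (by positivity)]
  rw [show -((d : ℝ) / 2) + -(d / 2) + d = 0 by ring, Real.rpow_zero, Complex.ofReal_one]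

theorem integrable_fourierSym_schwartz (ψ : 𝓢(EuclideanSpace ℝ (Fin d), ℂ)) :
    Integrable (fourierSym ψ) := by
  have h : Integrable (𝓕 (ψ : EuclideanSpace ℝ (Fin d) → ℂ)) := by
    rw [← SchwartzMap.fourier_coe]
    exact (𝓕 ψ).integrable
  have h2 := (h.comp_smul (inv_ne_zero (by positivity : 2 * Real.pi ≠ 0))).const_mul
    (((2 * Real.pi) ^ (-((d : ℝ) / 2)) : ℝ) : ℂ)
  exact h2.congr (Eventually.of_forall fun ξ => (fourierSym_eq_fourier _ ξ).symm)

theorem invFourier_fourierSym_schwartz (ψ : 𝓢(EuclideanSpace ℝ (Fin d), ℂ))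
    (x : EuclideanSpace ℝ (Fin d)) :
    (((2 * Real.pi) ^ (-((d : ℝ) / 2)) : ℝ) : ℂ) * invFourier (fourierSym ψ) x = ψ x := by
  have hp : (0 : ℝ) < 2 * Real.pi := by positivity
  have hF : Integrable (𝓕 (ψ : EuclideanSpace ℝ (Fin d) → ℂ)) := by
    rw [← SchwartzMap.fourier_coe]
    exact (𝓕 ψ).integrable
  have hinv := congrFun (ψ.continuous.fourierInv_fourier_eq ψ.integrable hF) x
  rw [Real.fourierInv_eq'] at hinv
  have h := Measure.integral_comp_smul_of_nonneg (volume : Measure (EuclideanSpace ℝ (Fin d)))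
    (fun v => Complex.exp (↑(2 * Real.pi * inner ℝ v x) * Complex.I) • 𝓕 (ψ : EuclideanSpace ℝ (Fin d) → ℂ) v)
    (2 * Real.pi)⁻¹ (hR := by positivity)
  rw [hinv, finrank_euclideanSpace_fin, inv_pow, inv_inv] at h
  have h2 : invFourier (fourierSym ψ) x = (((2 * Real.pi) ^ (-((d : ℝ) / 2)) : ℝ) : ℂ) *
      ∫ ξ : EuclideanSpace ℝ (Fin d), Complex.exp (↑(2 * Real.pi * inner ℝ ((2 * Real.pi)⁻¹ • ξ) x) * Complex.I) • 𝓕 (ψ : EuclideanSpace ℝ (Fin d) → ℂ) ((2 * Real.pi)⁻¹ • ξ) := by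
    rw [← integral_const_mul, invFourier]
    refine integral_congr_ae (Eventually.of_forall fun ξ => ?_)
    simp only
    rw [fourierSym_eq_fourier, real_inner_smul_left, mul_inv_cancel_left₀ hp.ne', real_inner_comm, smul_eq_mul,
      mul_comm Complex.I]
    ring
  rw [h2, h, ← mul_assoc, Complex.real_smul, ← mul_assoc, two_pi_rpow_mul_self, one_mul]

/-- The symbol `∏ (i ξ_j)^{α_j}` of `∂^α`. -/
noncomputable def derivSymbol (α : Fin d → ℕ) (ξ : EuclideanSpace ℝ (Fin d)) : ℂ :=
  ∏ i, (Complex.I * (ξ i : ℂ)) ^ α i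

theorem continuous_derivSymbol (α : Fin d → ℕ) : Continuous (derivSymbol α) := by
  unfold derivSymbol
  fun_prop

theorem derivSymbol_neg (α : Fin d → ℕ) (ξ : EuclideanSpace ℝ (Fin d)) :
    derivSymbol α (-ξ) = (-1) ^ (∑ i, α i) * derivSymbol α ξ := by
  rw [derivSymbol, derivSymbol, ← Finset.prod_pow_eq_pow_sum, ← Finset.prod_mul_distrib]
  refine Finset.prod_congr rfl fun i _ => ?_
  rw [← mul_pow]
  simp

theorem one_le_bracket (ξ : EuclideanSpace ℝ (Fin d)) : 1 ≤ bracket ξ := by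
  rw [bracket, Real.one_le_sqrt]
  nlinarith [norm_nonneg ξ]

theorem norm_le_bracket (ξ : EuclideanSpace ℝ (Fin d)) : ‖ξ‖ ≤ bracket ξ :=
  Real.le_sqrt_of_sq_le (by linarith)

theorem norm_derivSymbol_le {α : Fin d → ℕ} {ℓ : ℕ} (hα : ∑ i, α i ≤ ℓ)
    (ξ : EuclideanSpace ℝ (Fin d)) : ‖derivSymbol α ξ‖ ≤ bracket ξ ^ ℓ := by
  rw [derivSymbol, norm_prod]
  calc ∏ i, ‖(Complex.I * (ξ i : ℂ)) ^ α i‖ ≤ ∏ i, bracket ξ ^ α i := by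
        refine Finset.prod_le_prod (fun i _ => norm_nonneg _) fun i _ => ?_
        rw [norm_pow, norm_mul, Complex.norm_I, one_mul, Complex.norm_real]
        exact pow_le_pow_left₀ (norm_nonneg _) ((PiLp.norm_apply_le ξ i).trans (norm_le_bracket ξ)) _
    _ = bracket ξ ^ (∑ i, α i) := Finset.prod_pow_eq_pow_sum _ _ _
    _ ≤ _ := pow_le_pow_right₀ (one_le_bracket ξ) hα

/-- `ψ` is a test function whose Fourier transform is `m` times that of `φ`. -/
structure IsFourierMultiple (φ ψ : EuclideanSpace ℝ (Fin d) → ℝ)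
    (m : EuclideanSpace ℝ (Fin d) → ℂ) : Prop where
  contDiff : ContDiff ℝ ((⊤ : ℕ∞) : WithTop ℕ∞) ψ
  hasCompactSupport : HasCompactSupport ψ
  fourierSym_eq : ∀ ξ, fourierSym (fun x => (ψ x : ℂ)) ξ = m ξ * fourierSym (fun x => (φ x : ℂ)) ξ

/-- A real test function as a complex Schwartz function. -/
noncomputable def testSchwartz {ψ : EuclideanSpace ℝ (Fin d) → ℝ} (hψ : ContDiff ℝ ((⊤ : ℕ∞) : WithTop ℕ∞) ψ)
    (hc : HasCompactSupport ψ) : 𝓢(EuclideanSpace ℝ (Fin d), ℂ) :=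
  (hc.comp_left (g := fun t : ℝ => (t : ℂ)) rfl).toSchwartzMap (Complex.ofRealCLM.contDiff.comp hψ)

theorem coe_testSchwartz {ψ : EuclideanSpace ℝ (Fin d) → ℝ}
    (hψ : ContDiff ℝ ((⊤ : ℕ∞) : WithTop ℕ∞) ψ) (hc : HasCompactSupport ψ) :
    ⇑(testSchwartz hψ hc) = fun x => (ψ x : ℂ) := rfl

theorem IsFourierMultiple.lineDeriv {φ ψ : EuclideanSpace ℝ (Fin d) → ℝ}
    {m : EuclideanSpace ℝ (Fin d) → ℂ} (h : IsFourierMultiple φ ψ m) (i : Fin d) :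
    IsFourierMultiple φ (fun x => lineDeriv ℝ ψ x (EuclideanSpace.single i 1))
      (fun ξ => (Complex.I * (ξ i : ℂ)) * m ξ) := by
  have hd : Differentiable ℝ ψ := h.contDiff.differentiable (by simp)
  have e : (fun x => _root_.lineDeriv ℝ ψ x (EuclideanSpace.single i 1)) =
      fun x => fderiv ℝ ψ x (EuclideanSpace.single i 1) := by
    ext x
    exact (hd x).lineDeriv_eq_fderiv
  refine ⟨?_, ?_, fun ξ => ?_⟩
  · rw [e]
    exact (h.contDiff.fderiv_right (m := ((⊤ : ℕ∞) : WithTop ℕ∞)) (by simp)).clm_apply contDiff_const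
  · rw [e]
    exact h.hasCompactSupport.fderiv_apply ℝ _
  · set Ψ := testSchwartz h.contDiff h.hasCompactSupport with hΨ
    have e2 : (fun x => ((_root_.lineDeriv ℝ ψ x (EuclideanSpace.single i 1) : ℝ) : ℂ)) =
        ⇑(LineDeriv.lineDerivOp (EuclideanSpace.single i (1 : ℝ)) Ψ) := by
      ext x
      rw [SchwartzMap.lineDerivOp_apply_eq_fderiv, hΨ, coe_testSchwartz, (hd x).lineDeriv_eq_fderiv]
      have := (Complex.ofRealCLM.hasFDerivAt.comp x (hd x).hasFDerivAt).fderiv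
      have h3 : fderiv ℝ (fun x => (ψ x : ℂ)) x = Complex.ofRealCLM ∘L fderiv ℝ ψ x := this
      rw [h3]
      rfl
    have hm := h.fourierSym_eq ξ
    rw [fourierSym_eq_fourier (fun x => (ψ x : ℂ)), ← coe_testSchwartz h.contDiff h.hasCompactSupport, ← hΨ] at hm
    rw [mul_assoc (Complex.I * (ξ i : ℂ)), ← hm, e2, fourierSym_eq_fourier, ← SchwartzMap.fourier_coe,
      SchwartzMap.fourier_lineDerivOp_eq, smul_apply, SchwartzMap.smulLeftCLM_apply_apply (by fun_prop),
      SchwartzMap.fourier_coe, real_inner_smul_left, EuclideanSpace.inner_single_right]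
    simp only [smul_eq_mul, Complex.real_smul, conj_trivial, one_mul]
    push_cast
    have hpi : (Real.pi : ℂ) ≠ 0 := by exact_mod_cast Real.pi_ne_zero
    field_simp

theorem isFourierMultiple_partialDeriv {φ : EuclideanSpace ℝ (Fin d) → ℝ}
    (hφ : ContDiff ℝ ((⊤ : ℕ∞) : WithTop ℕ∞) φ) (hc : HasCompactSupport φ) (α : Fin d → ℕ) :
    IsFourierMultiple φ (partialDeriv α φ) (derivSymbol α) := by
  have hiter : ∀ (i : Fin d) (k : ℕ) (ψ : EuclideanSpace ℝ (Fin d) → ℝ) (m : EuclideanSpace ℝ (Fin d) → ℂ),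
      IsFourierMultiple φ ψ m → IsFourierMultiple φ
        ((fun h x => _root_.lineDeriv ℝ h x (EuclideanSpace.single i 1))^[k] ψ)
        (fun ξ => (Complex.I * (ξ i : ℂ)) ^ k * m ξ) := by
    intro i k ψ m h
    induction k with
    | zero => simpa using h
    | succ k ih =>
      rw [Function.iterate_succ_apply']
      simpa only [pow_succ', mul_assoc] using ih.lineDeriv i
  have hlist : ∀ l : List (Fin d), IsFourierMultiple φ
      (l.foldr (fun i g => (fun h x => _root_.lineDeriv ℝ h x (EuclideanSpace.single i 1))^[α i] g) φ)
      (fun ξ => (l.map fun i => (Complex.I * (ξ i : ℂ)) ^ α i).prod) := by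
    intro l
    induction l with
    | nil => exact ⟨hφ, hc, fun ξ => by simp⟩
    | cons i l ih => simpa using hiter i (α i) _ _ ih
  have := hlist (List.finRange d)
  simp only [← Fin.prod_univ_def] at this
  exact this

/-! ### Passage to the limit from truncations and the weak derivative -/

theorem eLpNorm_ofReal_eq {α : Type*} [MeasurableSpace α] {μ : Measure α} {p : ℝ} (hp : 0 < p)
    (f : α → ℂ) : eLpNorm f (ENNReal.ofReal p) μ = (∫⁻ x, ‖f x‖ₑ ^ p ∂μ) ^ (1 / p) := by
  rw [eLpNorm_eq_lintegral_rpow_enorm_toReal (by simpa using hp) ENNReal.ofReal_ne_top,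
    ENNReal.toReal_ofReal hp.le]

theorem memL1L2_indicator_closedBall {g : EuclideanSpace ℝ (Fin d) → ℂ} (hg : Continuous g)
    (R : ℝ) : MemL1L2 ((Metric.closedBall 0 R).indicator g) := by
  have hR : MeasurableSet (Metric.closedBall (0 : EuclideanSpace ℝ (Fin d)) R) :=
    measurableSet_closedBall
  obtain ⟨B, hB⟩ := (isCompact_closedBall (0 : EuclideanSpace ℝ (Fin d)) R).exists_bound_of_continuousOn
    hg.continuousOn
  have hfin : IsFiniteMeasure (volume.restrict (Metric.closedBall (0 : EuclideanSpace ℝ (Fin d)) R)) :=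
    ⟨by simpa using measure_closedBall_lt_top⟩
  have h : ∀ p : ℝ≥0∞, MemLp ((Metric.closedBall 0 R).indicator g) p := fun p => by
    rw [memLp_indicator_iff_restrict hR]
    refine MemLp.of_bound hg.aestronglyMeasurable B ?_
    filter_upwards [ae_restrict_mem hR] with ξ hξ
    exact hB ξ hξ
  exact ⟨hg.measurable.indicator hR, memLp_one_iff_integrable.1 (h 1), h 2⟩

/-- The weight can degenerate only at the origin. On the unit ball `g` is bounded by continuity, and
outside it `w ≥ w(1) > 0`. Membership in the unweighted `L^q` is what gives `g` an inverse transform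
in `L^{q'}`. -/
theorem lintegral_rpow_ne_top_of_weight {q q' : ℝ} (hq : 0 < q) {D : ℝ≥0} {w : ℝ → ℝ≥0∞}
    (hw : IsRadialWeight d q' D w) {g : EuclideanSpace ℝ (Fin d) → ℂ} (hg : Continuous g)
    (h : ∫⁻ ξ, (w ‖ξ‖ * ‖g ξ‖ₑ) ^ q ≠ ∞) : ∫⁻ ξ, ‖g ξ‖ₑ ^ q ≠ ∞ := by
  have hw0 := hw.ne_zero 1 one_pos
  have hwt := hw.ne_top 1
  have hwm := hw.mono.measurable
  obtain ⟨B, hB⟩ := (isCompact_closedBall (0 : EuclideanSpace ℝ (Fin d)) 1).exists_bound_of_continuousOn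
    hg.continuousOn
  set S := Metric.closedBall (0 : EuclideanSpace ℝ (Fin d)) 1 with hS
  rw [← lintegral_add_compl _ (measurableSet_closedBall : MeasurableSet S), ENNReal.add_ne_top]
  constructor
  · refine ne_top_of_le_ne_top (b := ∫⁻ _ in S, ENNReal.ofReal B ^ q) ?_ ?_
    · rw [setLIntegral_const]
      exact ENNReal.mul_ne_top (ENNReal.rpow_ne_top_of_nonneg hq.le ENNReal.ofReal_ne_top)
        measure_closedBall_lt_top.ne
    · refine setLIntegral_mono' measurableSet_closedBall fun ξ hξ => ?_
      rw [← ofReal_norm]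
      exact ENNReal.rpow_le_rpow (ENNReal.ofReal_le_ofReal (hB ξ hξ)) hq.le
  · refine ne_top_of_le_ne_top (b := (w 1)⁻¹ ^ q * ∫⁻ ξ, (w ‖ξ‖ * ‖g ξ‖ₑ) ^ q) ?_ ?_
    · exact ENNReal.mul_ne_top (ENNReal.rpow_ne_top_of_nonneg hq.le (ENNReal.inv_ne_top.2 hw0)) h
    · have hgm := hg.measurable
      rw [← lintegral_const_mul _ (by fun_prop)]
      refine (setLIntegral_mono' measurableSet_closedBall.compl fun ξ hξ => ?_).trans
        (setLIntegral_le_lintegral Sᶜ _)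
      rw [← ENNReal.mul_rpow_of_nonneg _ _ hq.le]
      refine ENNReal.rpow_le_rpow ?_ hq.le
      have hξ1 : 1 ≤ ‖ξ‖ := by
        have : ξ ∉ S := hξ
        rw [hS, mem_closedBall_zero_iff, not_le] at this
        exact this.le
      calc ‖g ξ‖ₑ = (w 1)⁻¹ * (w 1 * ‖g ξ‖ₑ) := by
            rw [← mul_assoc, ENNReal.inv_mul_cancel hw0 hwt, one_mul]
        _ ≤ _ := by
            gcongr
            exact hw.mono hξ1

theorem tendsto_lintegral_indicator_closedBall_sub {q : ℝ}
    {g : EuclideanSpace ℝ (Fin d) → ℂ} (hg : Continuous g) (h : ∫⁻ ξ, ‖g ξ‖ₑ ^ q ≠ ∞) :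
    Tendsto (fun n : ℕ => ∫⁻ ξ in (Metric.closedBall (0 : EuclideanSpace ℝ (Fin d)) n)ᶜ, ‖g ξ‖ₑ ^ q)
      atTop (𝓝 0) := by
  have hgm := hg.measurable
  have e : ∀ n : ℕ, ∫⁻ ξ in (Metric.closedBall (0 : EuclideanSpace ℝ (Fin d)) n)ᶜ, ‖g ξ‖ₑ ^ q =
      ∫⁻ ξ, (Metric.closedBall (0 : EuclideanSpace ℝ (Fin d)) n)ᶜ.indicator (fun ξ => ‖g ξ‖ₑ ^ q) ξ :=
    fun n => (lintegral_indicator measurableSet_closedBall.compl _).symm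
  simp only [e]
  rw [← lintegral_zero (α := EuclideanSpace ℝ (Fin d)) (μ := volume)]
  refine tendsto_lintegral_of_dominated_convergence (fun ξ => ‖g ξ‖ₑ ^ q)
    (fun n => Measurable.indicator (by fun_prop) measurableSet_closedBall.compl)
    (fun n => Eventually.of_forall fun ξ => Set.indicator_le_self _ _ _) h
    (Eventually.of_forall fun ξ => ?_)
  refine tendsto_const_nhds.congr' ?_
  filter_upwards [eventually_ge_atTop ⌈‖ξ‖⌉₊] with n hn
  rw [Set.indicator_of_notMem]
  simpa using Nat.ceil_le.1 hn

/-- The inverse Fourier transform of a continuous function in `L^q` is defined in `L^{q'}` as the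
limit of the transforms of the truncations. -/
theorem exists_tendsto_invFourier (hd : 0 < d) {q q' : ℝ} (hqq' : q.HolderConjugate q')
    (hle : q ≤ q') {g : EuclideanSpace ℝ (Fin d) → ℂ} (hg : Continuous g)
    (h : ∫⁻ ξ, ‖g ξ‖ₑ ^ q ≠ ∞) :
    ∃ u : EuclideanSpace ℝ (Fin d) → ℂ, MemLp u (ENNReal.ofReal q') ∧
      Tendsto (fun n : ℕ => eLpNorm (invFourier ((Metric.closedBall 0 n).indicator g) - u)
        (ENNReal.ofReal q') volume) atTop (𝓝 0) ∧
      ∀ n : ℕ, MemLp (invFourier ((Metric.closedBall 0 n).indicator g)) (ENNReal.ofReal q') := by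
  have hq : 1 < q := hqq'.lt
  have hq0 : 0 < q := hqq'.pos
  have hq'0 : 0 < q' := hqq'.symm.pos
  have hmul := hqq'.mul_eq_add
  have hq2 : q ≤ 2 := by nlinarith
  have hgm := hg.measurable
  -- For `r = q'` the power of `|x|` disappears: this is Hausdorff–Young with `q = 2` included.
  obtain ⟨C, hC⟩ := pitt_unweighted hd hqq' hle le_rfl
  simp only [div_self hq'0.ne', sub_self, mul_zero, ENNReal.rpow_zero, one_mul] at hC
  set G : ℕ → EuclideanSpace ℝ (Fin d) → ℂ := fun n => (Metric.closedBall 0 n).indicator g with hG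
  have hGn : ∀ n, MemL1L2 (G n) := fun n => memL1L2_indicator_closedBall hg n
  have hbound : ∀ k, MemL1L2 k → eLpNorm (invFourier k) (ENNReal.ofReal q') volume ≤
      (C * (∫⁻ ξ : EuclideanSpace ℝ (Fin d), ‖k ξ‖ₑ ^ q) ^ (q' / q)) ^ (1 / q') := fun k hk => by
    rw [eLpNorm_ofReal_eq hq'0]
    exact ENNReal.rpow_le_rpow (hC k hk) (by positivity)
  have hmem : ∀ n, MemLp (invFourier (G n)) (ENNReal.ofReal q') := fun n => by
    refine ⟨(hGn n).measurable_invFourier.aestronglyMeasurable, (hbound _ (hGn n)).trans_lt ?_⟩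
    refine (ENNReal.rpow_ne_top_of_nonneg (by positivity) (ENNReal.mul_ne_top ENNReal.coe_ne_top
      (ENNReal.rpow_ne_top_of_nonneg (by positivity) ?_))).lt_top
    exact (hGn n).lintegral_rpow_ne_top hq.le hq2
  have hfact : Fact (1 ≤ ENNReal.ofReal q') := ⟨by
    rw [ENNReal.one_le_ofReal]; exact hqq'.symm.lt.le⟩
  set a : ℕ → ℝ≥0∞ := fun N => ∫⁻ ξ in (Metric.closedBall (0 : EuclideanSpace ℝ (Fin d)) N)ᶜ, ‖g ξ‖ₑ ^ q with ha
  have ha0 : Tendsto a atTop (𝓝 0) := tendsto_lintegral_indicator_closedBall_sub hg h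
  have hcauchy : CauchySeq fun n => (hmem n).toLp (invFourier (G n)) := by
    rw [EMetric.cauchySeq_iff_le_tendsto_0]
    refine ⟨fun N => (C * a N ^ (q' / q)) ^ (1 / q'), fun n m N hn hm => ?_, ?_⟩
    · rw [Lp.edist_toLp_toLp]
      have e : invFourier (G n) - invFourier (G m) = invFourier (G n - G m) := by
        ext x
        rw [Pi.sub_apply, invFourier_sub (hGn n).integrable (hGn m).integrable]
      rw [e]
      refine (hbound _ ((hGn n).sub (hGn m))).trans ?_
      refine ENNReal.rpow_le_rpow (mul_le_mul_right (ENNReal.rpow_le_rpow ?_ (by positivity)) _)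
        (by positivity)
      simp only [ha]
      rw [← lintegral_indicator measurableSet_closedBall.compl]
      refine lintegral_mono fun ξ => ?_
      by_cases hξ : ξ ∈ Metric.closedBall (0 : EuclideanSpace ℝ (Fin d)) N
      · have h1 : ξ ∈ Metric.closedBall (0 : EuclideanSpace ℝ (Fin d)) n :=
          Metric.closedBall_subset_closedBall (by exact_mod_cast hn) hξ
        have h2 : ξ ∈ Metric.closedBall (0 : EuclideanSpace ℝ (Fin d)) m :=
          Metric.closedBall_subset_closedBall (by exact_mod_cast hm) hξ
        rw [Pi.sub_apply, hG]
        simp only [Set.indicator_of_mem h1, Set.indicator_of_mem h2, sub_self, enorm_zero]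
        rw [ENNReal.zero_rpow_of_pos hq0]
        exact zero_le
      · rw [Set.indicator_of_mem (by exact hξ)]
        refine ENNReal.rpow_le_rpow ?_ hq0.le
        rw [Pi.sub_apply, hG]
        classical
        simp only [Set.indicator_apply]
        split_ifs <;> simp
    · have h1 : Tendsto (fun N => a N ^ (q' / q)) atTop (𝓝 0) := by
        have := ha0.ennrpow_const (q' / q)
        rwa [ENNReal.zero_rpow_of_pos (by positivity)] at this
      have h2 := ENNReal.Tendsto.const_mul (a := (C : ℝ≥0∞)) h1 (Or.inr ENNReal.coe_ne_top)
      rw [mul_zero] at h2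
      have h3 := h2.ennrpow_const (1 / q')
      rwa [ENNReal.zero_rpow_of_pos (by positivity)] at h3
  obtain ⟨u, hu⟩ := cauchySeq_tendsto_of_complete hcauchy
  refine ⟨u, Lp.memLp u, ?_, hmem⟩
  rw [Lp.tendsto_Lp_iff_tendsto_eLpNorm'] at hu
  refine hu.congr fun n => eLpNorm_congr_ae ?_
  filter_upwards [(hmem n).coeFn_toLp] with x hx
  rw [Pi.sub_apply, hx, Pi.sub_apply]

/-- Convergence in `L^{q'}` gives an almost everywhere convergent subsequence, and Fatou's lemma
applies to it. Finiteness of `W` almost everywhere lets the product with `W` converge. -/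
theorem lintegral_le_of_tendsto_eLpNorm {q' r : ℝ} (hq' : 0 < q')
    {F : ℕ → EuclideanSpace ℝ (Fin d) → ℂ} {u : EuclideanSpace ℝ (Fin d) → ℂ}
    (hF : ∀ n, Measurable (F n)) (hu : AEStronglyMeasurable u)
    (hlim : Tendsto (fun n => eLpNorm (F n - u) (ENNReal.ofReal q') volume) atTop (𝓝 0))
    {W : EuclideanSpace ℝ (Fin d) → ℝ≥0∞} (hW : Measurable W) (hWt : ∀ᵐ x, W x ≠ ∞) {B : ℝ≥0∞}
    (hB : ∀ n, ∫⁻ x, (W x * ‖F n x‖ₑ) ^ r ≤ B) : ∫⁻ x, (W x * ‖u x‖ₑ) ^ r ≤ B := by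
  have hmeas := tendstoInMeasure_of_tendsto_eLpNorm (by simpa using hq')
    (fun n => (hF n).aestronglyMeasurable) hu hlim
  obtain ⟨ns, -, hns⟩ := hmeas.exists_seq_tendsto_ae
  calc ∫⁻ x, (W x * ‖u x‖ₑ) ^ r = ∫⁻ x, liminf (fun i => (W x * ‖F (ns i) x‖ₑ) ^ r) atTop := by
        refine lintegral_congr_ae ?_
        filter_upwards [hns, hWt] with x hx hWx
        refine (Tendsto.liminf_eq ?_).symm
        exact (ENNReal.Tendsto.const_mul hx.enorm (Or.inr hWx)).ennrpow_const r
    _ ≤ liminf (fun i => ∫⁻ x, (W x * ‖F (ns i) x‖ₑ) ^ r) atTop :=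
        lintegral_liminf_le fun i => by have := hF (ns i); fun_prop
    _ ≤ B := liminf_le_of_frequently_le' (Frequently.of_forall fun i => hB _)

theorem tendsto_integral_smul_of_tendsto_eLpNorm {q q' : ℝ} (hqq' : q.HolderConjugate q')
    {F : ℕ → EuclideanSpace ℝ (Fin d) → ℂ} {u : EuclideanSpace ℝ (Fin d) → ℂ}
    (hF : ∀ n, MemLp (F n) (ENNReal.ofReal q')) (hu : MemLp u (ENNReal.ofReal q'))
    (hlim : Tendsto (fun n => eLpNorm (F n - u) (ENNReal.ofReal q') volume) atTop (𝓝 0))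
    {φ : EuclideanSpace ℝ (Fin d) → ℝ} (hφ : Continuous φ) (hc : HasCompactSupport φ) :
    Tendsto (fun n => ∫ x, φ x • F n x) atTop (𝓝 (∫ x, φ x • u x)) := by
  have hq0 : 0 < q := hqq'.pos
  have hq'0 : 0 < q' := hqq'.symm.pos
  have hφq : MemLp φ (ENNReal.ofReal q) := hφ.memLp_of_hasCompactSupport hc
  have hφt : (∫⁻ x, ‖φ x‖ₑ ^ q) ^ (1 / q) ≠ ∞ := by
    have := hφq.2
    rw [eLpNorm_eq_lintegral_rpow_enorm_toReal (by simpa using hq0) ENNReal.ofReal_ne_top,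
      ENNReal.toReal_ofReal hq0.le] at this
    exact this.ne
  have h1le : (1 : ℝ≥0∞) ≤ ENNReal.ofReal q' := by
    rw [ENNReal.one_le_ofReal]; exact hqq'.symm.lt.le
  refine tendsto_integral_of_L1 _ (hφ.aestronglyMeasurable.smul hu.1)
    (Eventually.of_forall fun n => ?_) ?_
  · exact ((hF n).locallyIntegrable h1le).integrable_smul_left_of_hasCompactSupport hφ hc
  · have hup : ∀ n, ∫⁻ x, ‖φ x • F n x - φ x • u x‖ₑ ≤
        (∫⁻ x, ‖φ x‖ₑ ^ q) ^ (1 / q) * eLpNorm (F n - u) (ENNReal.ofReal q') volume := fun n => by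
      rw [eLpNorm_ofReal_eq hq'0]
      have := ENNReal.lintegral_mul_le_Lp_mul_Lq volume hqq' (f := fun x => ‖φ x‖ₑ)
        (g := fun x => ‖(F n - u) x‖ₑ) (hφ.measurable.enorm.aemeasurable) (((hF n).sub hu).1.enorm)
      refine le_trans (le_of_eq ?_) this
      refine lintegral_congr fun x => ?_
      rw [← smul_sub, enorm_smul]
      rfl
    have hz := ENNReal.Tendsto.const_mul (a := (∫⁻ x, ‖φ x‖ₑ ^ q) ^ (1 / q)) hlim (Or.inr hφt)
    rw [mul_zero] at hz
    exact tendsto_of_tendsto_of_tendsto_of_le_of_le tendsto_const_nhds hz (fun n => zero_le) hup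

theorem continuous_fourierSym {f : EuclideanSpace ℝ (Fin d) → ℂ} (hf : Integrable f) :
    Continuous (fourierSym f) := by
  have h : Continuous fun ξ => (((2 * Real.pi) ^ (-((d : ℝ) / 2)) : ℝ) : ℂ) * invFourier f (-ξ) :=
    continuous_const.mul ((continuous_invFourier hf).comp continuous_neg)
  exact h.congr fun ξ => (fourierSym_eq_invFourier f ξ).symm

/-- Parseval's formula turns `∫ ∂^α φ · f` into `∫ P G` up to sign, where `P` is the transform of
`φ` at `-ξ`. Restricted to balls, the same formula in reverse gives `∫ φ` against the transforms of
the truncations, which tend to `u`. Both limits exist, so they agree. -/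
theorem isWeakDerivOnOpen_of_tendsto {q q' : ℝ} (hqq' : q.HolderConjugate q')
    {f : EuclideanSpace ℝ (Fin d) → ℂ} (hf : Integrable f) (α : Fin d → ℕ)
    {u : EuclideanSpace ℝ (Fin d) → ℂ} (hu : MemLp u (ENNReal.ofReal q'))
    (hF : ∀ n : ℕ, MemLp (invFourier ((Metric.closedBall 0 n).indicator
      fun ξ => derivSymbol α ξ * fourierSym f ξ)) (ENNReal.ofReal q'))
    (hlim : Tendsto (fun n : ℕ => eLpNorm (invFourier ((Metric.closedBall 0 n).indicator
      fun ξ => derivSymbol α ξ * fourierSym f ξ) - u) (ENNReal.ofReal q') volume) atTop (𝓝 0)) :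
    IsWeakDerivOnOpen α f (fun x => (((2 * Real.pi) ^ (-((d : ℝ) / 2)) : ℝ) : ℂ) * u x)
      Set.univ := by
  have h1le : (1 : ℝ≥0∞) ≤ ENNReal.ofReal q' := by
    rw [ENNReal.one_le_ofReal]; exact hqq'.symm.lt.le
  refine ⟨hf.locallyIntegrable.locallyIntegrableOn _,
    ((hu.const_mul _).locallyIntegrable h1le).locallyIntegrableOn _, fun φ hφ hc _ => ?_⟩
  set c : ℂ := (((2 * Real.pi) ^ (-((d : ℝ) / 2)) : ℝ) : ℂ) with hcdef
  have hmult := isFourierMultiple_partialDeriv hφ hc α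
  set G : EuclideanSpace ℝ (Fin d) → ℂ := fun ξ => derivSymbol α ξ * fourierSym f ξ with hG
  have hGc : Continuous G := (continuous_derivSymbol α).mul (continuous_fourierSym hf)
  set Φ := testSchwartz hmult.contDiff hmult.hasCompactSupport with hΦ
  have hΦi := integrable_fourierSym_schwartz Φ
  have hφi : Integrable fun x => (φ x : ℂ) := (testSchwartz hφ hc).integrable
  set s : ℂ := (-1) ^ (∑ i, α i) with hs
  have hss : s * s = 1 := by rw [hs, ← mul_pow]; simp
  set P : EuclideanSpace ℝ (Fin d) → ℂ := fun ξ => c * invFourier (fun x => (φ x : ℂ)) ξ with hP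
  have hPneg : ∀ ξ, fourierSym (fun x => (φ x : ℂ)) (-ξ) = P ξ := fun ξ => by
    rw [fourierSym_eq_invFourier, neg_neg]
  have hΦneg : ∀ ξ, fourierSym Φ (-ξ) = s * (derivSymbol α ξ * P ξ) := fun ξ => by
    rw [hΦ, coe_testSchwartz, hmult.fourierSym_eq, derivSymbol_neg, hPneg, mul_assoc]
  have hstep1 : ∫ x, partialDeriv α φ x • f x = s * ∫ ξ, P ξ * G ξ := by
    calc ∫ x, partialDeriv α φ x • f x = ∫ x, c * (invFourier (fourierSym Φ) x * f x) := by
          refine integral_congr_ae (Eventually.of_forall fun x => ?_)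
          simp only
          rw [← mul_assoc, invFourier_fourierSym_schwartz, Complex.real_smul]
          rfl
      _ = c * ∫ ξ, fourierSym Φ ξ * invFourier f ξ := by
          rw [integral_const_mul, integral_invFourier_mul hΦi hf]
      _ = ∫ ξ, fourierSym Φ (-ξ) * (c * invFourier f (-ξ)) := by
          rw [← integral_neg_eq_self, ← integral_const_mul]
          refine integral_congr_ae (Eventually.of_forall fun x => ?_)
          simp only
          ring
      _ = s * ∫ ξ, P ξ * G ξ := by
          rw [← integral_const_mul]
          refine integral_congr_ae (Eventually.of_forall fun ξ => ?_)
          simp only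
          rw [hΦneg, ← fourierSym_eq_invFourier, hG]
          ring
  -- `G` itself need not be integrable. Up to sign, `P G` is the transform of `∂^α φ` at `-ξ`, which
  -- is integrable, times the bounded function `f̂`.
  have hPG : Integrable fun ξ => P ξ * G ξ := by
    have h1 : Integrable fun ξ => fourierSym Φ (-ξ) * fourierSym f ξ := by
      refine Integrable.mul_bdd (c := ‖c‖ * (∫⁻ x, ‖f x‖ₑ).toReal) hΦi.comp_neg
        (continuous_fourierSym hf).aestronglyMeasurable (Eventually.of_forall fun ξ => ?_)
      rw [fourierSym_eq_invFourier, norm_mul]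
      gcongr
      rw [← toReal_enorm]
      exact ENNReal.toReal_mono hf.2.ne (enorm_invFourier_le f _)
    refine (h1.const_mul s).congr (Eventually.of_forall fun ξ => ?_)
    simp only
    rw [hΦneg, hG]
    linear_combination (derivSymbol α ξ * P ξ * fourierSym f ξ) * hss
  have hlim1 := (tendsto_integral_smul_of_tendsto_eLpNorm hqq' hF hu hlim hφ.continuous hc).const_mul c
  have hlim2 : Tendsto (fun n : ℕ => ∫ ξ, (Metric.closedBall 0 (n : ℝ)).indicator (fun ξ => P ξ * G ξ) ξ)
      atTop (𝓝 (∫ ξ, P ξ * G ξ)) := by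
    refine tendsto_integral_of_dominated_convergence (fun ξ => ‖P ξ * G ξ‖)
      (fun n => hPG.1.indicator measurableSet_closedBall) hPG.norm
      (fun n => Eventually.of_forall fun ξ => norm_indicator_le_norm_self _ _)
      (Eventually.of_forall fun ξ => ?_)
    refine tendsto_const_nhds.congr' ?_
    filter_upwards [eventually_ge_atTop ⌈‖ξ‖⌉₊] with n hn
    rw [Set.indicator_of_mem]
    simpa using Nat.ceil_le.1 hn
  have heq : ∀ n : ℕ, c * ∫ x, φ x • invFourier ((Metric.closedBall 0 (n : ℝ)).indicator G) x =
      ∫ ξ, (Metric.closedBall 0 (n : ℝ)).indicator (fun ξ => P ξ * G ξ) ξ := fun n => by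
    have h1 := integral_invFourier_mul hφi (memL1L2_indicator_closedBall hGc n).integrable
    simp only [Complex.real_smul]
    rw [← h1, ← integral_const_mul]
    refine integral_congr_ae (Eventually.of_forall fun ξ => ?_)
    by_cases hξ : ξ ∈ Metric.closedBall (0 : EuclideanSpace ℝ (Fin d)) n
    · simp only [Set.indicator_of_mem hξ, hP, mul_assoc]
    · simp only [Set.indicator_of_notMem hξ, mul_zero]
  have hfinal : c * ∫ x, φ x • u x = ∫ ξ, P ξ * G ξ :=
    tendsto_nhds_unique (hlim1.congr heq) hlim2
  rw [hstep1, ← hfinal, ← integral_const_mul, Complex.real_smul]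
  push_cast
  rw [← hs]
  congr 1
  refine integral_congr_ae (Eventually.of_forall fun x => ?_)
  simp only [Complex.real_smul]
  ring

/-- The weighted estimate for a single weak derivative on the whole space. -/
theorem exists_weakDeriv_lintegral_le (hd : 0 < d) {q q' r : ℝ} (hqq' : q.HolderConjugate q')
    (hqr : q ≤ r) (hrq' : r ≤ q') (D : ℝ≥0) :
    ∃ C : ℝ≥0, ∀ w, IsRadialWeight d q' D w → ∀ (ℓ : ℕ) (f : EuclideanSpace ℝ (Fin d) → ℂ),
      Integrable f →
      ∫⁻ ξ, (w ‖ξ‖ * ‖((bracket ξ ^ ℓ : ℝ) : ℂ) * fourierSym f ξ‖ₑ) ^ q ≠ ∞ →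
      ∀ α : Fin d → ℕ, ∑ i, α i ≤ ℓ → ∃ g, IsWeakDerivOnOpen α f g Set.univ ∧
        ∫⁻ x, (‖x‖ₑ ^ (d * (1 / q' - 1 / r)) * w (1 / ‖x‖) * ‖g x‖ₑ) ^ r ≤
          C * (∫⁻ ξ, (w ‖ξ‖ * ‖((bracket ξ ^ ℓ : ℝ) : ℂ) * fourierSym f ξ‖ₑ) ^ q) ^ (r / q) := by
  have hq0 : 0 < q := hqq'.pos
  have hq'0 : 0 < q' := hqq'.symm.pos
  have hr0 : 0 < r := hq0.trans_le hqr
  obtain ⟨C, hC⟩ := pitt_weighted hd hqq' hqr hrq' D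
  set c : ℝ := (2 * Real.pi) ^ (-((d : ℝ) / 2)) with hc
  refine ⟨‖c‖₊ ^ r * C, fun w hw ℓ f hf hfin α hα => ?_⟩
  have hwm := hw.mono.measurable
  set N := ∫⁻ ξ, (w ‖ξ‖ * ‖((bracket ξ ^ ℓ : ℝ) : ℂ) * fourierSym f ξ‖ₑ) ^ q with hN
  set G : EuclideanSpace ℝ (Fin d) → ℂ := fun ξ => derivSymbol α ξ * fourierSym f ξ with hG
  have hGc : Continuous G := (continuous_derivSymbol α).mul (continuous_fourierSym hf)
  have hGN : ∀ ξ, (w ‖ξ‖ * ‖G ξ‖ₑ) ^ q ≤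
      (w ‖ξ‖ * ‖((bracket ξ ^ ℓ : ℝ) : ℂ) * fourierSym f ξ‖ₑ) ^ q := fun ξ => by
    refine ENNReal.rpow_le_rpow (mul_le_mul_right ?_ _) hq0.le
    rw [hG, enorm_mul, enorm_mul]
    gcongr
    rw [enorm_le_iff_norm_le, Complex.norm_real, Real.norm_of_nonneg (pow_nonneg (zero_le_one.trans (one_le_bracket ξ)) _)]
    exact norm_derivSymbol_le hα ξ
  have hGfin : ∫⁻ ξ, (w ‖ξ‖ * ‖G ξ‖ₑ) ^ q ≠ ∞ := ne_top_of_le_ne_top hfin (lintegral_mono hGN)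
  obtain ⟨u, hu, hlim, hF⟩ := exists_tendsto_invFourier hd hqq' (hqr.trans hrq') hGc
    (lintegral_rpow_ne_top_of_weight hq0 hw hGc hGfin)
  refine ⟨_, isWeakDerivOnOpen_of_tendsto hqq' hf α hu hF hlim, ?_⟩
  have hpow : ∀ y : EuclideanSpace ℝ (Fin d) → ℂ, ∫⁻ x, (‖x‖ₑ ^ (d * (1 / q' - 1 / r)) * w (1 / ‖x‖) * ‖y x‖ₑ) ^ r =
      ∫⁻ x, ‖x‖ₑ ^ (d * (r / q' - 1)) * (w (1 / ‖x‖) * ‖y x‖ₑ) ^ r := fun y => by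
    refine lintegral_congr fun x => ?_
    rw [mul_assoc, ENNReal.mul_rpow_of_nonneg _ _ hr0.le, ← ENNReal.rpow_mul]
    congr 2
    field_simp
  -- The weighted inequality holds for all truncations with the same bound, since truncating only
  -- decreases `|G|`; Fatou then carries it over to `u`.
  have hbound : ∫⁻ x, (‖x‖ₑ ^ (d * (1 / q' - 1 / r)) * w (1 / ‖x‖) * ‖u x‖ₑ) ^ r ≤ C * N ^ (r / q) := by
    refine lintegral_le_of_tendsto_eLpNorm hq'0
      (fun n => (memL1L2_indicator_closedBall hGc n).measurable_invFourier) hu.1 hlim (by fun_prop) ?_ fun n => ?_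
    · filter_upwards [ae_ne_zero hd] with x hx
      refine ENNReal.mul_ne_top ?_ (hw.ne_top _)
      rw [Ne, ENNReal.rpow_eq_top_iff]
      simp [hx]
    · rw [hpow]
      refine (hC w hw _ (memL1L2_indicator_closedBall hGc n)).trans ?_
      gcongr
      refine lintegral_mono fun ξ => le_trans ?_ (hGN ξ)
      gcongr
      rw [enorm_indicator_eq_indicator_enorm]
      exact Set.indicator_le_self _ _ _
  calc ∫⁻ x, (‖x‖ₑ ^ (d * (1 / q' - 1 / r)) * w (1 / ‖x‖) * ‖(c : ℂ) * u x‖ₑ) ^ r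
      = ∫⁻ x, ‖c‖ₑ ^ r * (‖x‖ₑ ^ (d * (1 / q' - 1 / r)) * w (1 / ‖x‖) * ‖u x‖ₑ) ^ r := by
        refine lintegral_congr fun x => ?_
        rw [enorm_mul, ← ENNReal.mul_rpow_of_nonneg _ _ hr0.le, ← ofReal_norm (c : ℂ), Complex.norm_real, ofReal_norm]
        congr 1
        ring
    _ = ‖c‖ₑ ^ r * ∫⁻ x, (‖x‖ₑ ^ (d * (1 / q' - 1 / r)) * w (1 / ‖x‖) * ‖u x‖ₑ) ^ r :=
        lintegral_const_mul' _ _ (ENNReal.rpow_ne_top_of_nonneg hr0.le enorm_ne_top)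
    _ ≤ ‖c‖ₑ ^ r * (C * N ^ (r / q)) := by gcongr
    _ = _ := by
        rw [ENNReal.coe_mul, ENNReal.coe_rpow_of_nonneg _ hr0.le, mul_assoc]
        rfl

end WeightedFourier

/-! ### The estimate on bounded sets -/

theorem mainTheorem6 (d ℓ : ℕ) (hd : 0 < d) (p q q' r : ℝ) (hp : 1 < p) (hq : 1 < q)
    (hqq' : q.HolderConjugate q') (hqr : q ≤ r) (hrq' : r ≤ q') (hpr : p ≤ r) (K : ℝ≥0) :
    ∃ C : ℝ≥0, ∀ υ : ℝ → ℝ, MonotoneOn υ (Set.Ici 0) →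
      WeightedFourier.IsMuckenhoupt q q' K (fun x : EuclideanSpace ℝ (Fin d) => υ ‖x‖) →
      ∀ ω ϑ : EuclideanSpace ℝ (Fin d) → ℝ,
      (∀ x, ω x = υ ‖x‖ ^ (1 / q)) →
      (∀ x, ϑ x = ‖x‖ ^ ((d : ℝ) * (1 / q' - 1 / r)) * υ (1 / ‖x‖) ^ (1 / q)) →
      ∀ U : Set (EuclideanSpace ℝ (Fin d)), MeasurableSet U → Bornology.IsBounded U →
      ∀ f : EuclideanSpace ℝ (Fin d) → ℂ,
      WeightedFourier.MemFourierLebesgue q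
        (fun ξ => ω ξ * WeightedFourier.bracket ξ ^ ℓ) f →
      WeightedFourier.MemSobolev ℓ p ϑ U f ∧
      WeightedFourier.sobolevENorm ℓ p ϑ U f ≤
        C * volume U ^ (1 / p - 1 / r) *
          WeightedFourier.fourierLebesgueENorm q
            (fun ξ => ω ξ * WeightedFourier.bracket ξ ^ ℓ) f := by
  have hp0 : 0 < p := by linarith
  have hq0 : 0 < q := hqq'.pos
  have hr0 : 0 < r := hq0.trans_le hqr
  obtain ⟨D, hD⟩ := WeightedFourier.IsMuckenhoupt.exists_isRadialWeight hd hqq' K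
  obtain ⟨C, hC⟩ := WeightedFourier.exists_weakDeriv_lintegral_le hd hqq' hqr hrq' D
  set M : ℕ := (WeightedFourier.multiIndices d ℓ).card with hM
  -- Each of the `M` multi-indices satisfies the same bound with `C^{1/r}`; the `ℓ^p` sum of `M`
  -- equal terms contributes `M^{1/p}`.
  refine ⟨(M : ℝ≥0) ^ (1 / p) * C ^ (1 / r), fun υ hmono hυ ω ϑ hω hϑ U hU hUb f hf => ?_⟩
  set w : ℝ → ℝ≥0∞ := fun t => ENNReal.ofReal (υ (max t 0)) ^ (1 / q) with hw
  have hwr : WeightedFourier.IsRadialWeight d q' D w := hD υ hmono hυ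
  have hυ0 : ∀ t, 0 ≤ t → 0 ≤ υ t := fun t ht => by
    have := hυ.nonneg (EuclideanSpace.single ⟨0, hd⟩ t)
    simpa [abs_of_nonneg ht] using this
  have hwυ : ∀ t, 0 ≤ t → w t = ‖υ t ^ (1 / q)‖ₑ := fun t ht => by
    simp only [hw]
    rw [Real.enorm_of_nonneg (Real.rpow_nonneg (hυ0 t ht) _),
      ← ENNReal.ofReal_rpow_of_nonneg (hυ0 t ht) (by positivity), max_eq_left ht]
  set N := WeightedFourier.fourierLebesgueENorm q
    (fun ξ => ω ξ * WeightedFourier.bracket ξ ^ ℓ) f with hNdef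
  have hNlt : N < ∞ := hf.2.2
  have hN : ∫⁻ ξ, (w ‖ξ‖ * ‖((WeightedFourier.bracket ξ ^ ℓ : ℝ) : ℂ) * WeightedFourier.fourierSym f ξ‖ₑ) ^ q =
      N ^ q := by
    rw [hNdef, WeightedFourier.fourierLebesgueENorm, WeightedFourier.eLpNorm_ofReal_eq hq0,
      ← ENNReal.rpow_mul, one_div_mul_cancel hq0.ne', ENNReal.rpow_one]
    refine lintegral_congr fun ξ => ?_
    rw [hwυ _ (norm_nonneg _), ← hω, Complex.ofReal_mul, mul_assoc, enorm_mul (ω ξ : ℂ),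
      ← ofReal_norm (ω ξ : ℂ), Complex.norm_real, ofReal_norm]
  have hNt : N ^ q ≠ ∞ := ENNReal.rpow_ne_top_of_nonneg hq0.le hNlt.ne
  have hUfin : volume U < ∞ := hUb.measure_lt_top
  have hUt : volume U ^ (1 / p - 1 / r) ≠ ∞ :=
    ENNReal.rpow_ne_top_of_nonneg (sub_nonneg.2 (one_div_le_one_div_of_le hp0 hpr)) hUfin.ne
  have hϑm : Measurable ϑ := by
    have h1 : Measurable fun t : ℝ => υ (max t 0) := Monotone.measurable fun s t hst =>
      hmono (Set.mem_Ici.2 (le_max_right _ _)) (Set.mem_Ici.2 (le_max_right _ _)) (max_le_max_right _ hst)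
    have h2 : ϑ = fun x => ‖x‖ ^ ((d : ℝ) * (1 / q' - 1 / r)) * υ (max (1 / ‖x‖) 0) ^ (1 / q) := by
      ext x
      rw [hϑ, max_eq_left (by positivity)]
    rw [h2]
    have h3 : Measurable fun x : EuclideanSpace ℝ (Fin d) => υ (max (1 / ‖x‖) 0) :=
      h1.comp (g := fun t : ℝ => υ (max t 0)) (by fun_prop : Measurable fun x : EuclideanSpace ℝ (Fin d) => 1 / ‖x‖)
    exact (measurable_norm.pow_const _).mul (h3.pow_const _)
  have key : ∀ α : Fin d → ℕ, ∑ i, α i ≤ ℓ → ∃ g, WeightedFourier.IsWeakDeriv α f g U ∧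
      AEStronglyMeasurable (fun x => (ϑ x : ℂ) * g x) (volume.restrict U) ∧
      eLpNorm (fun x => (ϑ x : ℂ) * g x) (ENNReal.ofReal p) (volume.restrict U) ≤
        (C : ℝ≥0∞) ^ (1 / r) * N * volume U ^ (1 / p - 1 / r) := by
    intro α hα
    obtain ⟨g, hg, hgb⟩ := hC w hwr ℓ f hf.1 (by rw [hN]; exact hNt) α hα
    have hgm : AEStronglyMeasurable g :=
      (locallyIntegrableOn_univ.1 hg.locallyIntegrableOn_right).aestronglyMeasurable
    have hm : AEStronglyMeasurable (fun x => (ϑ x : ℂ) * g x) (volume.restrict U) :=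
      ((Complex.measurable_ofReal.comp hϑm).aestronglyMeasurable.mul hgm).restrict
    refine ⟨g, ⟨Set.univ, isOpen_univ, Set.subset_univ _, hg⟩, hm, ?_⟩
    -- Hölder on `U`: the weak derivative and its `L^r` bound live on the whole space, and `U`
    -- contributes only this power of its volume.
    refine (eLpNorm_le_eLpNorm_mul_rpow_measure_univ (ENNReal.ofReal_le_ofReal hpr) hm).trans ?_
    rw [Measure.restrict_apply_univ, ENNReal.toReal_ofReal hp0.le, ENNReal.toReal_ofReal hr0.le]
    gcongr
    rw [WeightedFourier.eLpNorm_ofReal_eq hr0]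
    calc (∫⁻ x in U, ‖(ϑ x : ℂ) * g x‖ₑ ^ r) ^ (1 / r) ≤ (C * (N ^ q) ^ (r / q)) ^ (1 / r) := by
          refine ENNReal.rpow_le_rpow ?_ (by positivity)
          rw [← hN]
          refine ((setLIntegral_le_lintegral _ _).trans (le_of_eq ?_)).trans hgb
          refine lintegral_congr_ae ?_
          -- The origin is excluded because there a negative power of `‖x‖` is `0` in `ℝ` but `∞` in
          -- `ℝ≥0∞`.
          filter_upwards [WeightedFourier.ae_ne_zero hd] with x hx
          rw [hwυ _ (by positivity), ← WeightedFourier.enorm_rpow_eq_enorm hx, ← enorm_mul, ← hϑ,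
            enorm_mul, ← ofReal_norm (ϑ x : ℂ), Complex.norm_real, ofReal_norm]
      _ = _ := by
          rw [ENNReal.mul_rpow_of_nonneg _ _ (by positivity), ← ENNReal.rpow_mul, ← ENNReal.rpow_mul,
            show q * (r / q * (1 / r)) = 1 by field_simp, ENNReal.rpow_one]
  refine ⟨fun α hα => ?_, ?_⟩
  · obtain ⟨g, hg, hm, hle⟩ := key α hα
    refine ⟨g, hg, hm, hle.trans_lt ?_⟩
    exact (ENNReal.mul_ne_top (ENNReal.mul_ne_top
      (ENNReal.rpow_ne_top_of_nonneg (by positivity) ENNReal.coe_ne_top) hNlt.ne) hUt).lt_top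
  · rw [WeightedFourier.sobolevENorm]
    calc _ ≤ (∑ _α ∈ WeightedFourier.multiIndices d ℓ,
          ((C : ℝ≥0∞) ^ (1 / r) * N * volume U ^ (1 / p - 1 / r)) ^ p) ^ (1 / p) := by
          refine ENNReal.rpow_le_rpow (Finset.sum_le_sum fun α hα => ?_) (by positivity)
          obtain ⟨g, hg, -, hle⟩ := key α (WeightedFourier.mem_multiIndices.1 hα)
          exact ENNReal.rpow_le_rpow ((iInf₂_le g hg).trans hle) hp0.le
      _ = _ := by
          rw [Finset.sum_const, ← hM, nsmul_eq_mul, ENNReal.mul_rpow_of_nonneg _ _ (by positivity),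
            ← ENNReal.rpow_mul, mul_one_div_cancel hp0.ne', ENNReal.rpow_one, ENNReal.coe_mul,
            ENNReal.coe_rpow_of_nonneg _ (by positivity), ENNReal.coe_rpow_of_nonneg _ (by positivity),
            ENNReal.coe_natCast]
          ring
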